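/- Let $\mathbb T^2=\mathbb R^2/\mathbb Z^2$, $V\in C^\infty(\mathbb T^2;\mathbb R)$, and let $\Lambda\subset\mathbb Z^2$ be a primitive sublattice of rank one, that is, its real span $\langle\Lambda\rangle$ is a line and $\langle\Lambda\rangle\cap\mathbb Z^2=\Lambda$. Let $\mathfrak e_\Lambda$ be a generator of $\Lambda$, $\mathfrak e_\Lambda^\perp$ the vector of the same length directly orthogonal to it, and $L_\Lambda=\|\mathfrak e_\Lambda\|$. On $T^*\mathbb T^2=\mathbb T^2\times\mathbb R^2$ put $$H_\Lambda(x,\xi)=\tfrac1{L_\Lambda}\langle\xi,\mathfrak e_\Lambda\rangle,\quad H_\Lambda^\perp(x,\xi)=\tfrac1{L_\Lambda}\langle\xi,\mathfrak e_\Lambda^\perp\rangle,\quad \mathcal I_\Lambda(V)(x)=\tfrac1{L_\Lambda}\int_0^{L_\Lambda}V\big(x+s\,\mathfrak e_\Lambda^\perp/L_\Lambda\big)\,ds,\quad p_\Lambda=\tfrac12H_\Lambda^2+\mathcal I_\Lambda(V),$$ and let $\varphi^s_{H_\Lambda^\perp}$, $\varphi^t_{p_\Lambda}$ be the (commuting,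 complete) Hamiltonian flows of $H_\Lambda^\perp$ and $p_\Lambda$. Let $\mathcal R(\Lambda)$ be the complement in $T^*\mathbb T^2$ of $\{(x,\xi): H_\Lambda(x,\xi)=0,\ \partial_x\mathcal I_\Lambda(V)(x)=0\}$, let $\Phi=(H_\Lambda^\perp,p_\Lambda):\mathcal R(\Lambda)\to\mathbb R^2$ be the moment map, and let $\mathcal L_{(H,J)}=\Phi^{-1}(H,J)$. For $z\in\mathcal R(\Lambda)$ let $\mathcal L^{z}_{\Phi(z)}$ be the connected component of $\mathcal L_{\Phi(z)}$ containing $z$, and let $\mathcal R_c(\Lambda)$ be the set of those $z$ for which it is compact; it is then a torus, identified with $\mathbb R^2/G_z$ through $(s,t)\mapsto\varphi^s_{H_\Lambda^\perp}\varphi^t_{p_\Lambda}(z)$, where $G_z$ is the stabilizer of $z$, and its normalized Haar measure is the image of the Haar probability measure of $\mathbb R^2/G_z$. Let $\mu$ be a probability measure on $\mathcal R(\Lambda)$ invariant under $\varphi^t_{H_\Lambda^\perp}$ and $\varphi^t_{p_\Lambda}$ for all $t\in\mathbb R$, and set $\overline\mu=\Phi_*\mu$. Then $\overline\mu$-almost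 every $(H,J)$ belongs to $\Phi(\mathcal R_c(\Lambda))$, and there is a $\overline\mu$-measurable family of finite measures $\lambda_{H,J}$, $(H,J)\in\Phi(\mathcal R(\Lambda))$, such that for every $a\in C_c(\mathcal R(\Lambda))$ the inner integral below is a $\overline\mu$-integrable function of $(H,J)$ and $$\int_{\mathcal R(\Lambda)}a\,d\mu=\int_{\Phi(\mathcal R(\Lambda))}\int_{\mathcal L_{(H,J)}}a\,d\lambda_{H,J}\ \overline\mu(dH,dJ).$$ For every $(H,J)\in\Phi(\mathcal R_c(\Lambda))$ the measure $\lambda_{H,J}$ is a countable (finite or infinite) convex combination of the normalized Haar measures on the tori $\mathcal L^{z}_{(H,J)}$, $z\in\mathcal L_{(H,J)}\cap\mathcal R_c(\Lambda)$; for the other $(H,J)\in\Phi(\mathcal R(\Lambda))$, which form a $\overline\mu$-null set, $\lambda_{H,J}=0$. Moreover, for every $z\in\mathcal R(\Lambda)$, $$\mu\big(\{\varphi^s_{H_\Lambda^\perp}(z):0\le s\le L_\Lambda\}\big)=0.$$ -/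

import Mathlib

open MeasureTheory Set
open scoped ContDiff ENNReal

noncomputable section

namespace BiInvariant

/-- The Euclidean plane `ℝ²`. -/
abbrev Plane : Type := EuclideanSpace ℝ (Fin 2)

/-- The flat torus `𝕋² = ℝ²/ℤ²`. -/
abbrev Torus : Type := UnitAddTorus (Fin 2)

/-- The cotangent bundle `T*𝕋² = 𝕋² × ℝ²`, with points `z = (x, ξ)`. -/
abbrev Phase : Type := Torus × Plane

/-- The canonical projection `ℝ² → 𝕋²`. -/
def toTorus (y : Plane) : Torus := fun i => (y i : UnitAddCircle)

/-- A function on the torus is smooth when its periodic lift to the plane is. -/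
def SmoothOnTorus (f : Torus → ℝ) : Prop := ContDiff ℝ ∞ (fun y : Plane => f (toTorus y))

/-- The gradient `∂ₓ f (x)` of a function on the torus (with the flat metric). -/
def torusGradient (f : Torus → ℝ) (x : Torus) : Plane :=
  gradient (fun y : Plane => f (x + toTorus y)) 0

/-! ### Hamiltonian flows on `T*𝕋²` -/

/-- `∂ₓ h (x, ξ)`. -/
def gradPos (h : Phase → ℝ) (z : Phase) : Plane := torusGradient (fun x => h (x, z.2)) z.1

/-- `∂_ξ h (x, ξ)`. -/
def gradMom (h : Phase → ℝ) (z : Phase) : Plane := gradient (fun ξ => h (z.1, ξ)) z.2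

/-- `γ : ℝ → T*𝕋²` solves Hamilton's equations `x' = ∂_ξ h`, `ξ' = -∂ₓ h` for all times.
The velocity of the position is computed on a lift of it to the plane. -/
def IsHamiltonianCurve (h : Phase → ℝ) (γ : ℝ → Phase) : Prop :=
  ∃ X Ξ : ℝ → Plane, ∀ t : ℝ, γ t = (toTorus (X t), Ξ t) ∧
    HasDerivAt X (gradMom h (γ t)) t ∧ HasDerivAt Ξ (-gradPos h (γ t)) t

open Classical in
/-- The Hamiltonian flow `φ_h^t` on `T*𝕋²`. For the complete Hamiltonian vector fields of class
`C¹` to which it is applied, the solution curve through `z` exists and is unique. -/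
def hamiltonianFlow (h : Phase → ℝ) (t : ℝ) (z : Phase) : Phase :=
  if hz : ∃ γ : ℝ → Phase, IsHamiltonianCurve h γ ∧ γ 0 = z then hz.choose t else z

/-! ### Primitive lattices of rank one and the associated Hamiltonians -/

/-- An integer vector, seen in the plane. -/
def vec (e : Fin 2 → ℤ) : Plane := !₂[(e 0 : ℝ), (e 1 : ℝ)]

/-- The vector of the same length that is directly orthogonal to `e`. -/
def perp (e : Fin 2 → ℤ) : Plane := !₂[-(e 1 : ℝ), (e 0 : ℝ)]

/-- `Λ` is a primitive sublattice of `ℤ²` of rank one: its real span `⟨Λ⟩` is a line and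
`⟨Λ⟩ ∩ ℤ² = Λ`. -/
def IsPrimitiveRankOne (Λ : AddSubgroup (Fin 2 → ℤ)) : Prop :=
  Module.finrank ℝ (Submodule.span ℝ (vec '' (Λ : Set (Fin 2 → ℤ)))) = 1 ∧
    ∀ k : Fin 2 → ℤ, vec k ∈ Submodule.span ℝ (vec '' (Λ : Set (Fin 2 → ℤ))) → k ∈ Λ

/-- The length `L_Λ` of the generator `e = 𝔢_Λ` of `Λ`. -/
def len (e : Fin 2 → ℤ) : ℝ := ‖vec e‖

/-- `H_Λ (x, ξ) = ⟨ξ, 𝔢_Λ⟩ / L_Λ`. -/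
def hamPar (e : Fin 2 → ℤ) (z : Phase) : ℝ := 1 / len e * inner ℝ z.2 (vec e)

/-- `H_Λ^⊥ (x, ξ) = ⟨ξ, 𝔢_Λ^⊥⟩ / L_Λ`. -/
def hamPerp (e : Fin 2 → ℤ) (z : Phase) : ℝ := 1 / len e * inner ℝ z.2 (perp e)

/-- The average `I_Λ(V)(x)` of `V` along the closed geodesic through `x` directed
by `𝔢_Λ^⊥`, that is, along the `L_Λ`-periodic flow of `H_Λ^⊥`. -/
def average (e : Fin 2 → ℤ) (V : Torus → ℝ) (x : Torus) : ℝ :=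
  1 / len e * ∫ s in (0 : ℝ)..len e, V (x + toTorus ((s / len e) • perp e))

/-- `p_Λ (x, ξ) = H_Λ(x, ξ)² / 2 + I_Λ(V)(x)`. -/
def hamP (e : Fin 2 → ℤ) (V : Torus → ℝ) (z : Phase) : ℝ :=
  hamPar e z ^ 2 / 2 + average e V z.1

/-- The critical set `Crit_Λ(V)`. -/
def crit (e : Fin 2 → ℤ) (V : Torus → ℝ) : Set Phase :=
  {z | hamPar e z = 0 ∧ torusGradient (average e V) z.1 = 0}

/-- `R(Λ)`, the complement of the critical set. -/
def regular (e : Fin 2 → ℤ) (V : Torus → ℝ) : Set Phase := (crit e V)ᶜ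

/-! ### The moment map, its level sets, and the invariant tori -/

/-- The moment map `Φ = (H_Λ^⊥, p_Λ)`. -/
def moment (e : Fin 2 → ℤ) (V : Torus → ℝ) (z : Phase) : ℝ × ℝ := (hamPerp e z, hamP e V z)

/-- The level set `L_{(H,J)} = Φ⁻¹(H, J)` in `R(Λ)`. -/
def levelSet (e : Fin 2 → ℤ) (V : Torus → ℝ) (h : ℝ × ℝ) : Set Phase :=
  {z ∈ regular e V | moment e V z = h}

/-- The connected component of the level set of `z` that contains `z`. -/
def component (e : Fin 2 → ℤ) (V : Torus → ℝ) (z : Phase) : Set Phase :=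
  connectedComponentIn (levelSet e V (moment e V z)) z

/-- `R_c(Λ)`: the points of `R(Λ)` whose component of the level set is compact. -/
def compactPart (e : Fin 2 → ℤ) (V : Torus → ℝ) : Set Phase :=
  {z ∈ regular e V | IsCompact (component e V z)}

/-- The orbit map `φ_z (s, t) = φ_{H_Λ^⊥}^s (φ_{p_Λ}^t z)` of the action of `ℝ²`. -/
def orbitMap (e : Fin 2 → ℤ) (V : Torus → ℝ) (z : Phase) (w : ℝ × ℝ) : Phase :=
  hamiltonianFlow (hamPerp e) w.1 (hamiltonianFlow (hamP e V) w.2 z)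

/-- The group `G_z` of periods of the orbit map of `z`. Since the two flows commute, so that
`ℝ²` acts, this is the stabilizer of `z`. -/
def periodGroup (e : Fin 2 → ℤ) (V : Torus → ℝ) (z : Phase) : AddSubgroup (ℝ × ℝ) where
  carrier := {g | ∀ w, orbitMap e V z (g + w) = orbitMap e V z w}
  zero_mem' := fun w => by rw [zero_add]
  add_mem' := fun {a b} ha hb w => by rw [add_assoc, ha, hb]
  neg_mem' := fun {a} ha w => by rw [← ha (-a + w), add_neg_cancel_left]

/-- The map `ℝ²/G_z → T*𝕋²` induced by the orbit map. -/
def torusMap (e : Fin 2 → ℤ) (V : Torus → ℝ) (z : Phase) :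
    (ℝ × ℝ) ⧸ periodGroup e V z → Phase :=
  fun q => Quotient.liftOn' q (orbitMap e V z) fun a b hab => by
    have h := QuotientAddGroup.leftRel_apply.mp hab a
    rw [neg_add_cancel_comm] at h
    exact h.symm

/-- `m` is the normalized Haar measure on the torus through `z`: the image under
`ℝ²/G_z → T*𝕋²` of the Haar probability measure of the group `ℝ²/G_z`. -/
def IsTorusHaar (e : Fin 2 → ℤ) (V : Torus → ℝ) (z : Phase) (m : Measure Phase) : Prop :=
  ∃ ν : Measure ((ℝ × ℝ) ⧸ periodGroup e V z),
    ν.IsAddHaarMeasure ∧ IsProbabilityMeasure ν ∧ m = ν.map (torusMap e V z)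

/-- `m` is a (countable) convex combination of normalized Haar measures on the compact connected
components of the level set of `h`. -/
def IsConvexCombOfTori (e : Fin 2 → ℤ) (V : Torus → ℝ) (h : ℝ × ℝ) (m : Measure Phase) : Prop :=
  ∃ (z : ℕ → Phase) (c : ℕ → ℝ≥0∞) (τ : ℕ → Measure Phase),
    (∀ n, z n ∈ levelSet e V h ∩ compactPart e V) ∧
    (∀ n, IsTorusHaar e V (z n) (τ n)) ∧
    ∑' n, c n = 1 ∧
    m = Measure.sum (fun n => c n • τ n)

end BiInvariant

end

open BiInvariant

/-! In the orthonormal coordinates along `unitPar` and `unitPerp`, the averaged potential depends on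
the first position coordinate q alone, through a profile W. The flow of `hamPerp` translates the
second position coordinate; that of `hamP` solves Newton's equation q'' = -W'(q). Together they form
an action of ℝ², explicit on lifts (`IsProfile.orbitMap_eq`).

At a regular point the energy level is locally a single Newton trajectory
(`IsNewtonCurve.eventually_mem_image`), so orbits are relatively open in the level sets of the
moment map. Hence the orbits are the connected components (`IsProfile.component_eq`), and by second
countability each level set contains only countably many.

Condition μ on the moment map. Almost every conditional measure is invariant and carried by its
level set (`IsProfile.ae_condDistrib`), so it splits over countably many orbits. On an orbit of
positive mass it pulls back to a finite translation-invariant measure on ℝ²/G_z; this is a Haar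
measure, and its finiteness forces the quotient to be compact
(`IsProfile.isTorusHaar_of_invariant`). Only tori are charged.

The last claim does not use the disintegration: images of an arc under the `hamP` flow at distinct
small times are disjoint and of equal mass, and infinitely many of them fit in a finite measure
(`IsProfile.measure_arc_eq_zero`). -/

namespace BiInvariant

/-! ### Newton's equation on the line. -/

section Newton

open Filter Topology
open scoped NNReal

/-- The derivative under the integral sign for a `C¹` integrand on a compact interval. -/
theorem hasDerivAt_intervalIntegral_of_contDiff {g : ℝ → ℝ → ℝ}
    (hg : ContDiff ℝ 1 (fun p : ℝ × ℝ => g p.1 p.2)) (a b x : ℝ) :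
    HasDerivAt (fun q => ∫ s in a..b, g q s) (∫ s in a..b, deriv (fun q => g q s) x) x := by
  have hd : ∀ q s, HasDerivAt (fun q => g q s)
      (fderiv ℝ (fun p : ℝ × ℝ => g p.1 p.2) (q, s) (1, 0)) q := by
    intro q s
    have h1 := ((hg.differentiable one_ne_zero) (q, s)).hasFDerivAt
    exact h1.comp_hasDerivAt q ((hasDerivAt_id q).prodMk (hasDerivAt_const q s))
  have hc : Continuous (fun p : ℝ × ℝ => fderiv ℝ (fun p : ℝ × ℝ => g p.1 p.2) p (1, 0)) :=
    (hg.continuous_fderiv one_ne_zero).clm_apply continuous_const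
  obtain ⟨C, hC⟩ := ((isCompact_closedBall x 1).prod (isCompact_uIcc (a := a) (b := b)))
    |>.exists_bound_of_continuousOn hc.continuousOn
  have hgc : Continuous (fun p : ℝ × ℝ => g p.1 p.2) := hg.continuous
  have key := intervalIntegral.hasDerivAt_integral_of_dominated_loc_of_deriv_le (μ := volume)
    (F := g) (F' := fun q s => fderiv ℝ (fun p : ℝ × ℝ => g p.1 p.2) (q, s) (1, 0))
    (a := a) (b := b) (x₀ := x) (s := Metric.ball x 1) (bound := fun _ => C)
    (Metric.ball_mem_nhds x one_pos)
    (Eventually.of_forall fun q =>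
      (hgc.comp (by fun_prop : Continuous fun s : ℝ => (q, s))).aestronglyMeasurable)
    ((hgc.comp (by fun_prop : Continuous fun s : ℝ => (x, s))).intervalIntegrable a b)
    ((hc.comp (by fun_prop : Continuous fun s : ℝ => (x, s))).aestronglyMeasurable)
    (Eventually.of_forall fun s hs q hq =>
      hC (q, s) ⟨Metric.ball_subset_closedBall hq, uIoc_subset_uIcc hs⟩)
    intervalIntegrable_const
    (Eventually.of_forall fun s _ q _ => hd q s)
  have h2 := key.2
  simp only [fun s => (hd x s).deriv]
  exact h2

theorem continuous_intervalIntegral_of_continuous {g : ℝ → ℝ → ℝ}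
    (hg : Continuous (fun p : ℝ × ℝ => g p.1 p.2)) (a b : ℝ) :
    Continuous fun q => ∫ s in a..b, g q s :=
  intervalIntegral.continuous_parametric_intervalIntegral_of_continuous' hg a b

/-- A solution `(q, η)` of Newton's equation `q' = η`, `η' = -f(q)` on the line. -/
def IsNewtonCurve (f : ℝ → ℝ) (γ : ℝ → ℝ × ℝ) : Prop :=
  ∀ t, HasDerivAt γ ((γ t).2, -f (γ t).1) t

theorem IsNewtonCurve.comp_add {f : ℝ → ℝ} {γ : ℝ → ℝ × ℝ} (h : IsNewtonCurve f γ) (a : ℝ) :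
    IsNewtonCurve f (fun t => γ (t + a)) := fun t => (h (t + a)).comp_add_const t a

theorem lipschitzWith_newtonField {f : ℝ → ℝ} {K : ℝ≥0} (hf : LipschitzWith K f) :
    LipschitzWith (max 1 K) (fun x : ℝ × ℝ => (x.2, -f x.1)) := by
  have h := (LipschitzWith.prod_snd (α := ℝ) (β := ℝ)).prodMk
    ((hf.comp (LipschitzWith.prod_fst (α := ℝ) (β := ℝ))).neg)
  simpa using h

theorem IsNewtonCurve.unique {f : ℝ → ℝ} {K : ℝ≥0} (hf : LipschitzWith K f)
    {γ δ : ℝ → ℝ × ℝ} (hγ : IsNewtonCurve f γ) (hδ : IsNewtonCurve f δ) (h0 : γ 0 = δ 0) :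
    γ = δ :=
  ODE_solution_unique_univ (v := fun _ x => (x.2, -f x.1)) (s := fun _ => univ) (t₀ := 0)
    (fun _ => (lipschitzWith_newtonField hf).lipschitzOnWith) (fun t => ⟨hγ t, mem_univ _⟩)
    (fun t => ⟨hδ t, mem_univ _⟩) h0

open scoped Manifold in
/-- A globally Lipschitz vector field of class `C¹` is complete. -/
theorem exists_hasDerivAt_of_lipschitzWith {E : Type*} [NormedAddCommGroup E] [NormedSpace ℝ E]
    [CompleteSpace E] {v : E → E} {K : ℝ≥0} (hv : ContDiff ℝ 1 v) (hK : LipschitzWith K v)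
    (x : E) : ∃ γ : ℝ → E, γ 0 = x ∧ ∀ t, HasDerivAt γ (v (γ t)) t := by
  have hcm : ContMDiff 𝓘(ℝ, E) 𝓘(ℝ, E).tangent 1
      (fun x : E ↦ (⟨x, v x⟩ : TangentBundle 𝓘(ℝ, E) E)) := by
    exact contMDiff_vectorSpace_iff_contDiff.2 hv
  -- On the ball of radius ‖v y‖/(K+1) about y the field is bounded by 2‖v y‖, so Picard-Lindelöf
  -- gives the existence time 1/(2(K+1)), the same for all y. A uniform existence time yields global
  -- solutions.
  have hε : (0 : ℝ) < 1 / (2 * (K + 1)) := by positivity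
  obtain ⟨γ, h0, h⟩ := exists_isMIntegralCurve_of_isMIntegralCurveOn (v := v) hcm hε (fun y => by
    set ε : ℝ := 1 / (2 * (K + 1)) with hεd
    have hpl : IsPicardLindelof (fun _ => v) (tmin := -ε) (tmax := ε) ⟨0, by simp [hε.le]⟩ y
        (‖v y‖₊ / (K + 1)) 0 (2 * ‖v y‖₊) K := by
      apply IsPicardLindelof.of_time_independent
      · intro z hz
        have h1 := hK.norm_sub_le z y
        have h2 : ‖z - y‖ ≤ ‖v y‖ / (K + 1) := by simpa [dist_eq_norm] using hz
        have h3 : (K : ℝ) * (‖v y‖ / (K + 1)) ≤ ‖v y‖ := by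
          rw [← mul_div_assoc, div_le_iff₀ (by positivity)]
          nlinarith [norm_nonneg (v y)]
        have h4 := norm_le_norm_sub_add (v z) (v y)
        have h5 : (K : ℝ) * ‖z - y‖ ≤ K * (‖v y‖ / (K + 1)) := by gcongr
        push_cast
        linarith
      · exact hK.lipschitzOnWith
      · simp only [sub_zero, zero_sub, neg_neg, max_self, hεd]
        push_cast
        apply le_of_eq
        field_simp
        simp
    obtain ⟨α, hα0, hα⟩ := hpl.exists_eq_forall_mem_Icc_hasDerivWithinAt₀
    refine ⟨α, hα0, fun t ht => ?_⟩
    have := (hα t (Ioo_subset_Icc_self ht)).hasDerivAt (Icc_mem_nhds ht.1 ht.2)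
    exact this.hasFDerivAt.hasMFDerivAt.hasMFDerivWithinAt) x
  refine ⟨γ, h0, fun t => ?_⟩
  exact hasDerivAt_iff_hasFDerivAt.2 (hasMFDerivAt_iff_hasFDerivAt.1 (h t))

theorem exists_isNewtonCurve {f : ℝ → ℝ} {K : ℝ≥0} (hf : LipschitzWith K f)
    (hf1 : ContDiff ℝ 1 f) (x : ℝ × ℝ) : ∃ γ, IsNewtonCurve f γ ∧ γ 0 = x := by
  obtain ⟨γ, h0, h⟩ := exists_hasDerivAt_of_lipschitzWith (v := fun x : ℝ × ℝ => (x.2, -f x.1))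
    (by fun_prop) (lipschitzWith_newtonField hf) x
  exact ⟨γ, h, h0⟩

theorem exists_injOn_nhds_of_hasStrictDerivAt {g : ℝ → ℝ} {g' a : ℝ}
    (hg : HasStrictDerivAt g g' a) (hg' : g' ≠ 0) : ∃ T ∈ 𝓝 a, InjOn g T := by
  have h := (hg.hasStrictFDerivAt_equiv hg').eventually_left_inverse
  exact ⟨_, h, fun x hx y hy hxy => by
    have hx' := mem_ofPred.1 hx
    have hy' := mem_ofPred.1 hy
    rw [← hx', ← hy', hxy]⟩

theorem IsNewtonCurve.continuous {f : ℝ → ℝ} {γ : ℝ → ℝ × ℝ} (h : IsNewtonCurve f γ) :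
    Continuous γ := continuous_iff_continuousAt.2 fun t => (h t).continuousAt

theorem IsNewtonCurve.hasStrictDerivAt {f : ℝ → ℝ} {γ : ℝ → ℝ × ℝ} (h : IsNewtonCurve f γ)
    (hf : Continuous f) (t : ℝ) :
    HasStrictDerivAt (fun t => (γ t).1) (γ t).2 t ∧
      HasStrictDerivAt (fun t => (γ t).2) (-f (γ t).1) t := by
  have hc := h.continuous
  exact ⟨hasStrictDerivAt_of_hasDerivAt_of_continuousAt
      (Eventually.of_forall fun s => (h s).fst) (by fun_prop),
    hasStrictDerivAt_of_hasDerivAt_of_continuousAt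
      (Eventually.of_forall fun s => (h s).snd) (by fun_prop)⟩

theorem IsNewtonCurve.energy_eq {W f : ℝ → ℝ} (hW : ∀ q, HasDerivAt W (f q) q)
    {γ : ℝ → ℝ × ℝ} (h : IsNewtonCurve f γ) (t : ℝ) :
    (γ t).2 ^ 2 / 2 + W (γ t).1 = (γ 0).2 ^ 2 / 2 + W (γ 0).1 := by
  have hd : ∀ t, HasDerivAt (fun t => (γ t).2 ^ 2 / 2 + W (γ t).1) 0 t := by
    intro t
    have h1 : HasDerivAt (fun t => (γ t).1) (γ t).2 t := (h t).fst
    have h2 : HasDerivAt (fun t => (γ t).2) (-f (γ t).1) t := (h t).snd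
    convert! ((h2.pow 2).div_const 2).add ((hW (γ t).1).comp t h1) using 1
    simp
    ring
  exact is_const_of_deriv_eq_zero (fun t => (hd t).differentiableAt) (fun t => (hd t).deriv) t 0

/-- Near a point that is not an equilibrium, the energy level is covered by the solution curve. -/
theorem IsNewtonCurve.eventually_mem_image {W f : ℝ → ℝ} (hW : ∀ q, HasDerivAt W (f q) q)
    (hf : Continuous f) {γ : ℝ → ℝ × ℝ} (h : IsNewtonCurve f γ)
    (hne : (γ 0).2 ≠ 0 ∨ f (γ 0).1 ≠ 0) {T : Set ℝ} (hT : T ∈ 𝓝 (0 : ℝ)) :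
    ∀ᶠ x in 𝓝 (γ 0), x.2 ^ 2 / 2 + W x.1 = (γ 0).2 ^ 2 / 2 + W (γ 0).1 → x ∈ γ '' T := by
  have hc := h.continuous
  have hs := h.hasStrictDerivAt hf 0
  have t1 : Tendsto (fun x : ℝ × ℝ => x.1) (𝓝 (γ 0)) (𝓝 (γ 0).1) := continuous_fst.continuousAt
  have t2 : Tendsto (fun x : ℝ × ℝ => x.2) (𝓝 (γ 0)) (𝓝 (γ 0).2) := continuous_snd.continuousAt
  by_cases h0 : (γ 0).2 = 0
  -- At a turning point the velocity serves as local time coordinate, and the position is recovered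
  -- from the energy because W is locally injective.
  · have hf0 : f (γ 0).1 ≠ 0 := hne.resolve_left (not_not.2 h0)
    have hWs : HasStrictDerivAt W (f (γ 0).1) (γ 0).1 :=
      hasStrictDerivAt_of_hasDerivAt_of_continuousAt (Eventually.of_forall hW) hf.continuousAt
    obtain ⟨N, hN, hinj⟩ := exists_injOn_nhds_of_hasStrictDerivAt hWs hf0
    have hq : ∀ᶠ t in 𝓝 (0 : ℝ), (γ t).1 ∈ N :=
      (continuous_fst.comp hc).continuousAt.eventually_mem hN
    have himg : (fun t => (γ t).2) '' (T ∩ {t | (γ t).1 ∈ N}) ∈ 𝓝 (γ 0).2 := by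
      rw [← hs.2.map_nhds_eq (neg_ne_zero.2 hf0)]
      exact image_mem_map (inter_mem hT hq)
    filter_upwards [t2 himg, t1 hN] with x hx2 hx1 hE
    obtain ⟨t, ⟨htT, htN⟩, ht⟩ := hx2
    refine ⟨t, htT, Prod.ext ?_ ht⟩
    refine hinj htN hx1 ?_
    have := h.energy_eq hW t
    simp only at ht
    rw [ht] at this
    linarith
  -- Otherwise the position is the local time coordinate; the energy gives the square of the
  -- velocity, and its sign is that of the initial velocity.
  · have hq : ∀ᶠ t in 𝓝 (0 : ℝ), 0 < (γ t).2 * (γ 0).2 :=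
      ((continuous_snd.comp hc).mul continuous_const).continuousAt.eventually_const_lt
        (by simpa using mul_self_pos.2 h0)
    have hq2 : ∀ᶠ x in 𝓝 (γ 0), 0 < x.2 * (γ 0).2 :=
      (continuous_snd.mul continuous_const).continuousAt.eventually_const_lt
        (by simpa using mul_self_pos.2 h0)
    have himg : (fun t => (γ t).1) '' (T ∩ {t | 0 < (γ t).2 * (γ 0).2}) ∈ 𝓝 (γ 0).1 := by
      rw [← hs.1.map_nhds_eq h0]
      exact image_mem_map (inter_mem hT hq)
    filter_upwards [t1 himg, hq2] with x hx1 hx2 hE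
    obtain ⟨t, ⟨htT, htN⟩, ht⟩ := hx1
    refine ⟨t, htT, Prod.ext ht ?_⟩
    have := h.energy_eq hW t
    simp only at ht
    rw [ht] at this
    have h3 : (γ t).2 ^ 2 = x.2 ^ 2 := by linarith
    rcases sq_eq_sq_iff_eq_or_eq_neg.1 h3 with h4 | h4
    · exact h4
    · have h5 : 0 < (γ t).2 * (γ 0).2 := htN
      rw [h4] at h5
      linarith

/-- Away from equilibria a solution is injective for short times, even modulo translations of
the position by multiples of a given length. -/
theorem IsNewtonCurve.exists_injOn {f : ℝ → ℝ} (hf : Continuous f) {γ : ℝ → ℝ × ℝ}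
    (h : IsNewtonCurve f γ) (hne : (γ 0).2 ≠ 0 ∨ f (γ 0).1 ≠ 0) {l : ℝ} (hl : 0 < l) :
    ∃ T ∈ 𝓝 (0 : ℝ), ∀ t ∈ T, ∀ t' ∈ T, ∀ k : ℤ, (γ t).1 - (γ t').1 = k * l →
      (γ t).2 = (γ t').2 → t = t' := by
  have hc := h.continuous
  have hs := h.hasStrictDerivAt hf 0
  obtain ⟨T, hT, hinj⟩ : ∃ T ∈ 𝓝 (0 : ℝ), InjOn γ T := by
    rcases hne with h0 | h0
    · obtain ⟨T, hT, hi⟩ := exists_injOn_nhds_of_hasStrictDerivAt hs.1 h0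
      exact ⟨T, hT, fun x hx y hy hxy => hi hx hy (congrArg Prod.fst hxy)⟩
    · obtain ⟨T, hT, hi⟩ := exists_injOn_nhds_of_hasStrictDerivAt hs.2 (neg_ne_zero.2 h0)
      exact ⟨T, hT, fun x hx y hy hxy => hi hx hy (congrArg Prod.snd hxy)⟩
  -- Two positions within l/2 of the start differ by less than l, which forces k = 0.
  have hsm : ∀ᶠ t in 𝓝 (0 : ℝ), (γ t).1 ∈ Metric.ball (γ 0).1 (l / 2) :=
    (continuous_fst.comp hc).continuousAt.eventually_mem (Metric.ball_mem_nhds _ (by linarith))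
  refine ⟨T ∩ {t | (γ t).1 ∈ Metric.ball (γ 0).1 (l / 2)}, inter_mem hT hsm, ?_⟩
  rintro t ⟨htT, ht⟩ t' ⟨htT', ht'⟩ k hk h2
  refine hinj htT htT' (Prod.ext ?_ h2)
  have h3 : |(γ t).1 - (γ t').1| < l := by
    have := dist_triangle_right (γ t).1 (γ t').1 (γ 0).1
    have a1 : dist (γ t).1 (γ 0).1 < l / 2 := ht
    have a2 : dist (γ t').1 (γ 0).1 < l / 2 := ht'
    rw [Real.dist_eq] at this
    linarith
  rw [hk, abs_mul, abs_of_pos hl] at h3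
  have h4 : |(k : ℝ)| < 1 := by
    by_contra hcon
    nlinarith [not_lt.1 hcon]
  have h5 : k = 0 := by
    rw [← Int.abs_lt_one_iff]
    exact_mod_cast h4
  rw [h5] at hk
  simpa [sub_eq_zero] using hk

end Newton

/-! ### Orthonormal coordinates adapted to the lattice, and lifts from the torus to the plane. -/

section Coordinates

/-- The unit vector `𝔢_Λ / L_Λ`. -/
noncomputable def unitPar (e : Fin 2 → ℤ) : Plane := (1 / len e) • vec e

/-- The unit vector `𝔢_Λ^⊥ / L_Λ`. -/
noncomputable def unitPerp (e : Fin 2 → ℤ) : Plane := (1 / len e) • perp e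

theorem len_sq (e : Fin 2 → ℤ) : len e ^ 2 = (e 0 : ℝ) ^ 2 + (e 1 : ℝ) ^ 2 := by
  rw [len, EuclideanSpace.norm_sq_eq]
  simp [vec, Fin.sum_univ_two]

theorem len_pos {e : Fin 2 → ℤ} (he : e ≠ 0) : 0 < len e := by
  have h0 : 0 ≤ len e := norm_nonneg _
  refine lt_of_le_of_ne h0 fun h => he ?_
  have h1 := len_sq e
  rw [← h] at h1
  have h2 : (e 0 : ℝ) = 0 := by nlinarith [sq_nonneg (e 0 : ℝ), sq_nonneg (e 1 : ℝ)]
  have h3 : (e 1 : ℝ) = 0 := by nlinarith [sq_nonneg (e 0 : ℝ), sq_nonneg (e 1 : ℝ)]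
  funext i
  fin_cases i
  · exact_mod_cast h2
  · exact_mod_cast h3

theorem inner_plane (x y : Plane) : inner ℝ x y = x 0 * y 0 + x 1 * y 1 := by
  simp [PiLp.inner_apply, Fin.sum_univ_two, mul_comm]

theorem unitPar_apply (e : Fin 2 → ℤ) :
    unitPar e 0 = e 0 / len e ∧ unitPar e 1 = e 1 / len e := by
  constructor <;> simp [unitPar, vec] <;> ring

theorem unitPerp_apply (e : Fin 2 → ℤ) :
    unitPerp e 0 = -e 1 / len e ∧ unitPerp e 1 = e 0 / len e := by
  constructor <;> simp [unitPerp, perp] <;> ring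

variable {e : Fin 2 → ℤ}

theorem inner_unitPar_unitPar (he : e ≠ 0) : inner ℝ (unitPar e) (unitPar e) = 1 := by
  have h := (len_pos he).ne'
  rw [inner_plane, (unitPar_apply e).1, (unitPar_apply e).2]
  field_simp
  rw [len_sq]

theorem inner_unitPerp_unitPar : inner ℝ (unitPerp e) (unitPar e) = 0 := by
  rw [inner_plane, (unitPerp_apply e).1, (unitPerp_apply e).2, (unitPar_apply e).1,
    (unitPar_apply e).2]
  ring

theorem inner_unitPar_unitPerp : inner ℝ (unitPar e) (unitPerp e) = 0 := by
  rw [real_inner_comm, inner_unitPerp_unitPar]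

theorem eq_inner_smul_add (he : e ≠ 0) (y : Plane) :
    y = inner ℝ y (unitPar e) • unitPar e + inner ℝ y (unitPerp e) • unitPerp e := by
  have h := (len_pos he).ne'
  ext i
  fin_cases i <;>
  · simp only [inner_plane, PiLp.add_apply, PiLp.smul_apply, smul_eq_mul, Fin.zero_eta,
      Fin.mk_one, (unitPerp_apply e).1, (unitPerp_apply e).2, (unitPar_apply e).1,
      (unitPar_apply e).2]
    field_simp
    rw [len_sq]
    ring

theorem hamPar_eq (z : Phase) : hamPar e z = inner ℝ z.2 (unitPar e) := by
  simp [hamPar, unitPar, inner_smul_right]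

theorem hamPerp_eq (z : Phase) : hamPerp e z = inner ℝ z.2 (unitPerp e) := by
  simp [hamPerp, unitPerp, inner_smul_right]

theorem toTorus_add (x y : Plane) : toTorus (x + y) = toTorus x + toTorus y := by
  funext i
  simp [toTorus]

theorem continuous_toTorus : Continuous toTorus := by
  unfold toTorus
  exact continuous_pi fun i => (AddCircle.continuous_mk' 1).comp (by fun_prop)

theorem toTorus_surjective : Function.Surjective toTorus := by
  intro x
  choose y hy using fun i => QuotientAddGroup.mk_surjective (x i)
  exact ⟨WithLp.toLp 2 y, funext fun i => hy i⟩

theorem toTorus_eq_iff (x y : Plane) :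
    toTorus x = toTorus y ↔ ∃ k : Fin 2 → ℤ, x = y + vec k := by
  constructor
  · intro h
    have h1 : ∀ i, ∃ k : ℤ, x i - y i = k := by
      intro i
      have := congrFun h i
      have h2 := (QuotientAddGroup.eq_iff_sub_mem).1 this
      obtain ⟨k, hk⟩ := AddSubgroup.mem_zmultiples_iff.1 h2
      exact ⟨k, by simpa using hk.symm⟩
    choose k hk using h1
    refine ⟨k, ?_⟩
    ext i
    fin_cases i
    · simpa [vec, sub_eq_iff_eq_add'] using hk 0
    · simpa [vec, sub_eq_iff_eq_add'] using hk 1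
  · rintro ⟨k, rfl⟩
    funext i
    fin_cases i <;> simp [toTorus, vec]

theorem isOpenMap_toTorus : IsOpenMap toTorus := by
  have h1 : IsOpenMap (fun (y : Fin 2 → ℝ) (i : Fin 2) => (y i : UnitAddCircle)) :=
    IsOpenMap.piMap (fun i => QuotientAddGroup.isOpenMap_coe) (by simp)
  exact h1.comp (EuclideanSpace.equiv (Fin 2) ℝ).toHomeomorph.isOpenMap

end Coordinates

/-! ### The averaged potential as a function of one variable. -/

section Dynamics

open Filter Topology
open scoped NNReal

variable {e : Fin 2 → ℤ} {V : Torus → ℝ} {W f : ℝ → ℝ}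

/-- `W` is the potential `I_Λ(V)` as a function of the coordinate `⟨y, 𝔢_Λ⟩ / L_Λ`, and `f` is
its derivative. -/
structure IsProfile (e : Fin 2 → ℤ) (V : Torus → ℝ) (W f : ℝ → ℝ) : Prop where
  average_eq : ∀ y : Plane, average e V (toTorus y) = W (inner ℝ y (unitPar e))
  hasDerivAt : ∀ q, HasDerivAt W (f q) q
  contDiff : ContDiff ℝ 1 f
  lipschitz : ∃ K, LipschitzWith K f

theorem len_smul_unitPar (he : e ≠ 0) : len e • unitPar e = vec e := by
  rw [unitPar, smul_smul, mul_one_div_cancel (len_pos he).ne', one_smul]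

theorem len_smul_unitPerp (he : e ≠ 0) : len e • unitPerp e = vec ![-e 1, e 0] := by
  rw [unitPerp, smul_smul, mul_one_div_cancel (len_pos he).ne', one_smul]
  simp [perp, vec]

theorem toTorus_add_vec (y : Plane) (k : Fin 2 → ℤ) : toTorus (y + vec k) = toTorus y :=
  (toTorus_eq_iff _ _).2 ⟨k, rfl⟩

theorem average_toTorus (y : Plane) : average e V (toTorus y) =
    1 / len e * ∫ s in (0 : ℝ)..len e, V (toTorus (y + s • unitPerp e)) := by
  simp only [average, toTorus_add, unitPerp, smul_smul, mul_one_div]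

/-- Shifting by r only moves the window of integration, and the integrand has period `len e` since
`len e • unitPerp e` is an integer vector. -/
theorem average_toTorus_add_smul (he : e ≠ 0) (y : Plane) (r : ℝ) :
    average e V (toTorus (y + r • unitPerp e)) = average e V (toTorus y) := by
  have hper : Function.Periodic (fun s : ℝ => V (toTorus (y + s • unitPerp e))) (len e) := by
    intro s
    simp only [add_smul, ← add_assoc, len_smul_unitPerp he, toTorus_add_vec]
  rw [average_toTorus, average_toTorus]
  congr 1
  have h1 := intervalIntegral.integral_comp_add_left
    (fun s : ℝ => V (toTorus (y + s • unitPerp e))) r (a := 0) (b := len e)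
  simp only [add_smul, ← add_assoc] at h1
  rw [h1, add_zero]
  simpa using hper.intervalIntegral_add_eq r 0

theorem average_toTorus_eq (he : e ≠ 0) (y : Plane) : average e V (toTorus y) =
    average e V (toTorus (inner ℝ y (unitPar e) • unitPar e)) := by
  conv_lhs => rw [eq_inner_smul_add he y]
  rw [average_toTorus_add_smul he]

theorem exists_lipschitzWith_of_periodic {f : ℝ → ℝ} (hf : ContDiff ℝ 1 f) {l : ℝ} (hl : 0 < l)
    (hp : Function.Periodic f l) : ∃ K, LipschitzWith K f := by
  have hc : Continuous (deriv f) := hf.continuous_deriv le_rfl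
  have hpd : Function.Periodic (deriv f) l := by
    intro x
    rw [← deriv_comp_add_const]
    congr 1
    funext y
    exact hp y
  obtain ⟨C, hC⟩ := (isCompact_Icc (a := 0) (b := l)).exists_bound_of_continuousOn hc.continuousOn
  refine ⟨C.toNNReal, lipschitzWith_of_nnnorm_deriv_le (hf.differentiable one_ne_zero) fun x => ?_⟩
  obtain ⟨y, hy, hxy⟩ := hpd.exists_mem_Ico₀ hl x
  rw [hxy, ← NNReal.coe_le_coe, coe_nnnorm]
  exact (hC y (Ico_subset_Icc_self hy)).trans (Real.le_coe_toNNReal C)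

/-- W is the average restricted to the line through 0 along `unitPar`. Differentiating twice under
the integral makes f of class C¹; f is periodic because `len e • unitPar e` is an integer vector,
hence globally Lipschitz. -/
theorem exists_isProfile (he : e ≠ 0) (hV : SmoothOnTorus V) : ∃ W f, IsProfile e V W f := by
  set g : ℝ → ℝ → ℝ := fun q s => V (toTorus (q • unitPar e + s • unitPerp e)) with hg
  have hg2 : ContDiff ℝ 2 (fun p : ℝ × ℝ => g p.1 p.2) := by
    have h : ContDiff ℝ 2 (fun y : Plane => V (toTorus y)) := hV.of_le (by norm_cast)
    exact h.comp (f := fun p : ℝ × ℝ => p.1 • unitPar e + p.2 • unitPerp e) (by fun_prop)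
  set g1 : ℝ → ℝ → ℝ := fun q s => deriv (fun q => g q s) q with hg1d
  have hg1 : ContDiff ℝ 1 (fun p : ℝ × ℝ => g1 p.1 p.2) := by
    have h0 : ContDiff ℝ 1 (fun p => fderiv ℝ (fun p : ℝ × ℝ => g p.1 p.2) p (1, 0)) :=
      (hg2.fderiv_right (m := 1) (by norm_num)).clm_apply contDiff_const
    convert! h0 using 2 with p
    have h1 := ((hg2.differentiable two_ne_zero) p).hasFDerivAt
    exact (h1.comp_hasDerivAt p.1
      ((hasDerivAt_id p.1).prodMk (hasDerivAt_const p.1 p.2))).deriv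
  set g2 : ℝ → ℝ → ℝ := fun q s => deriv (fun q => g1 q s) q with hg2d
  have hg2c : Continuous (fun p : ℝ × ℝ => g2 p.1 p.2) := by
    have h0 : Continuous (fun p => fderiv ℝ (fun p : ℝ × ℝ => g1 p.1 p.2) p (1, 0)) :=
      (hg1.continuous_fderiv one_ne_zero).clm_apply continuous_const
    convert! h0 using 2 with p
    have h1 := ((hg1.differentiable one_ne_zero) p).hasFDerivAt
    exact (h1.comp_hasDerivAt p.1
      ((hasDerivAt_id p.1).prodMk (hasDerivAt_const p.1 p.2))).deriv
  set W : ℝ → ℝ := fun q => 1 / len e * ∫ s in (0 : ℝ)..len e, g q s with hW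
  set f : ℝ → ℝ := fun q => 1 / len e * ∫ s in (0 : ℝ)..len e, g1 q s with hf
  have hWd : ∀ q, HasDerivAt W (f q) q := fun q =>
    (hasDerivAt_intervalIntegral_of_contDiff (hg2.of_le one_le_two) 0 (len e) q).const_mul _
  have hfd : ∀ q, HasDerivAt f (1 / len e * ∫ s in (0 : ℝ)..len e, g2 q s) q := fun q =>
    (hasDerivAt_intervalIntegral_of_contDiff hg1 0 (len e) q).const_mul _
  have hfc : ContDiff ℝ 1 f := by
    rw [contDiff_one_iff_deriv]
    refine ⟨fun q => (hfd q).differentiableAt, ?_⟩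
    rw [funext fun q => (hfd q).deriv]
    exact continuous_const.mul (continuous_intervalIntegral_of_continuous hg2c 0 (len e))
  have hper : Function.Periodic f (len e) := by
    intro q
    have h1 : ∀ q s, g (q + len e) s = g q s := by
      intro q s
      simp only [hg, add_smul, len_smul_unitPar he]
      rw [add_right_comm, toTorus_add_vec]
    have h2 : ∀ s, g1 (q + len e) s = g1 q s := by
      intro s
      simp only [hg1d]
      rw [← deriv_comp_add_const]
      simp only [h1]
    simp only [hf, h2]
  refine ⟨W, f, ⟨fun y => ?_, hWd, hfc, exists_lipschitzWith_of_periodic hfc (len_pos he) hper⟩⟩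
  rw [average_toTorus_eq he, average_toTorus]

/-! ### Gradients and explicit Hamiltonian flows. -/

/-- The constant c lets one computation serve both for `hamP` (c the kinetic energy) and for the
critical set (c = 0). -/
theorem IsProfile.torusGradient_eq (h : IsProfile e V W f) (c : ℝ) (y : Plane) :
    torusGradient (fun x => c + average e V x) (toTorus y) =
      f (inner ℝ y (unitPar e)) • unitPar e := by
  apply HasGradientAt.gradient
  simp only [← toTorus_add, h.average_eq]
  have h1 : HasFDerivAt (fun y' : Plane => inner ℝ (y + y') (unitPar e))
      (innerSL ℝ (unitPar e)) 0 := by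
    have := (innerSL ℝ (unitPar e)).hasFDerivAt (x := 0)
    refine (this.const_add (inner ℝ y (unitPar e))).congr_of_eventuallyEq
      (Eventually.of_forall fun x => ?_)
    simp [inner_add_left, real_inner_comm]
  have h2 : HasDerivAt W (f (inner ℝ y (unitPar e))) (inner ℝ (y + 0) (unitPar e)) := by
    simpa using h.hasDerivAt (inner ℝ y (unitPar e))
  have h3 := (h2.comp_hasFDerivAt (0 : Plane) h1).const_add c
  rw [hasGradientAt_iff_hasFDerivAt]
  convert! h3 using 1
  ext x
  simp

theorem IsProfile.gradPos_hamP (h : IsProfile e V W f) (y ξ : Plane) :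
    gradPos (hamP e V) (toTorus y, ξ) = f (inner ℝ y (unitPar e)) • unitPar e := by
  have := h.torusGradient_eq (hamPar e (toTorus y, ξ) ^ 2 / 2) y
  simpa only [gradPos, hamP, hamPar] using this

theorem hasFDerivAt_inner_left (c ξ : Plane) :
    HasFDerivAt (fun ξ : Plane => inner ℝ ξ c) (innerSL ℝ c) ξ := by
  refine ((innerSL ℝ c).hasFDerivAt (x := ξ)).congr_of_eventuallyEq
    (Eventually.of_forall fun x => ?_)
  simp [real_inner_comm]

theorem gradMom_hamP (x : Torus) (ξ : Plane) :
    gradMom (hamP e V) (x, ξ) = inner ℝ ξ (unitPar e) • unitPar e := by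
  apply HasGradientAt.gradient
  simp only [hamP, hamPar_eq]
  rw [hasGradientAt_iff_hasFDerivAt]
  have h1 := hasFDerivAt_inner_left (unitPar e) ξ
  have h2 : HasDerivAt (fun t : ℝ => t ^ 2 / 2 + average e V x)
      (inner ℝ ξ (unitPar e)) (inner ℝ ξ (unitPar e)) := by
    convert! ((hasDerivAt_pow 2 _).div_const 2).add_const (average e V x) using 1
    simp
  have h3 := h2.comp_hasFDerivAt ξ h1
  convert! h3 using 1
  ext x
  simp

theorem gradMom_hamPerp (z : Phase) : gradMom (hamPerp e) z = unitPerp e := by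
  apply HasGradientAt.gradient
  simp only [hamPerp_eq]
  rw [hasGradientAt_iff_hasFDerivAt]
  convert! hasFDerivAt_inner_left (unitPerp e) z.2 using 1

theorem gradPos_hamPerp (z : Phase) : gradPos (hamPerp e) z = 0 := by
  simp only [gradPos, torusGradient, hamPerp]
  exact gradient_const _ _

/-- The flow is defined by choosing a curve, so its value is known once all admissible curves agree
at time t. -/
theorem hamiltonianFlow_eq {h : Phase → ℝ} {z p : Phase} {t : ℝ}
    (hex : ∃ γ : ℝ → Phase, IsHamiltonianCurve h γ ∧ γ 0 = z)
    (huniq : ∀ γ : ℝ → Phase, IsHamiltonianCurve h γ → γ 0 = z → γ t = p) :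
    hamiltonianFlow h t z = p := by
  rw [hamiltonianFlow, dif_pos hex]
  exact huniq _ hex.choose_spec.1 hex.choose_spec.2

theorem eq_add_smul_of_hasDerivAt {X : ℝ → Plane} {a a' : ℝ → ℝ} {u : Plane}
    (hX : ∀ t, HasDerivAt X (a' t • u) t) (ha : ∀ t, HasDerivAt a (a' t) t) (t : ℝ) :
    X t = X 0 + (a t - a 0) • u := by
  have hd : ∀ t, HasDerivAt (fun t => X t - a t • u) 0 t := fun t => by
    have := (hX t).sub ((ha t).smul_const u)
    rw [sub_self] at this
    exact this
  have := is_const_of_deriv_eq_zero (fun t => (hd t).differentiableAt) (fun t => (hd t).deriv) t 0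
  simp only [sub_eq_iff_eq_add] at this
  rw [this, sub_smul]
  abel

theorem hamiltonianFlow_hamPerp (s : ℝ) (y ξ : Plane) :
    hamiltonianFlow (hamPerp e) s (toTorus y, ξ) = (toTorus (y + s • unitPerp e), ξ) := by
  apply hamiltonianFlow_eq
  · refine ⟨fun s => (toTorus (y + s • unitPerp e), ξ), ⟨fun s => y + s • unitPerp e, fun _ => ξ,
      fun t => ⟨rfl, ?_, ?_⟩⟩, by simp⟩
    · rw [gradMom_hamPerp]
      simpa using ((hasDerivAt_id t).smul_const (unitPerp e)).const_add y
    · rw [gradPos_hamPerp, neg_zero]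
      exact hasDerivAt_const t ξ
  · rintro γ ⟨X, Ξ, h⟩ h0
    have hX : ∀ t, HasDerivAt X ((1 : ℝ) • unitPerp e) t := fun t => by
      simpa [gradMom_hamPerp] using (h t).2.1
    have hΞ : ∀ t, HasDerivAt Ξ ((0 : ℝ) • unitPerp e) t := fun t => by
      simpa [gradPos_hamPerp] using (h t).2.2
    have e1 := eq_add_smul_of_hasDerivAt hX (fun t => hasDerivAt_id t) s
    have e2 := eq_add_smul_of_hasDerivAt hΞ (fun t => hasDerivAt_const t (0 : ℝ)) s
    have h0' := (h 0).1.symm.trans h0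
    rw [Prod.mk.injEq] at h0'
    rw [(h s).1, e1, e2]
    simp [toTorus_add, h0'.1, h0'.2]

/-- Two lifts of one torus point have the same gradient. This absorbs the ambiguity of lifts in the
uniqueness of the flow. -/
theorem IsProfile.apply_add_inner_vec (h : IsProfile e V W f) (he : e ≠ 0) (k : Fin 2 → ℤ)
    (q : ℝ) : f (q + inner ℝ (vec k) (unitPar e)) = f q := by
  have h1 := h.torusGradient_eq 0 (q • unitPar e + vec k)
  rw [toTorus_add_vec, h.torusGradient_eq 0 (q • unitPar e)] at h1
  have h2 := congrArg (fun v => inner ℝ v (unitPar e)) h1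
  simp only [inner_add_left, real_inner_smul_left, inner_unitPar_unitPar he, mul_one] at h2
  exact h2.symm

/-- For uniqueness, the lift of any competing curve starts at y + k with k an integer vector. Its
components along `unitPar` solve Newton's equation, as does γ shifted by the component of k, so the
two coincide; the motion stays parallel to `unitPar`. -/
theorem IsProfile.hamiltonianFlow_hamP (h : IsProfile e V W f) (he : e ≠ 0) {γ : ℝ → ℝ × ℝ}
    (hγ : IsNewtonCurve f γ) {y ξ : Plane}
    (h0 : γ 0 = (inner ℝ y (unitPar e), inner ℝ ξ (unitPar e))) (t : ℝ) :
    hamiltonianFlow (hamP e V) t (toTorus y, ξ) =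
      (toTorus (y + ((γ t).1 - (γ 0).1) • unitPar e),
        ξ + ((γ t).2 - (γ 0).2) • unitPar e) := by
  have hu := inner_unitPar_unitPar he
  apply hamiltonianFlow_eq
  · refine ⟨fun t => (toTorus (y + ((γ t).1 - (γ 0).1) • unitPar e),
        ξ + ((γ t).2 - (γ 0).2) • unitPar e),
      ⟨fun t => y + ((γ t).1 - (γ 0).1) • unitPar e,
        fun t => ξ + ((γ t).2 - (γ 0).2) • unitPar e, fun t => ⟨rfl, ?_, ?_⟩⟩, by simp⟩
    · rw [gradMom_hamP]
      have : inner ℝ (ξ + ((γ t).2 - (γ 0).2) • unitPar e) (unitPar e) = (γ t).2 := by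
        rw [inner_add_left, real_inner_smul_left, hu, h0]
        ring
      rw [this]
      have hd : HasDerivAt (fun t => (γ t).1) (γ t).2 t := (hγ t).fst
      exact ((hd.sub_const _).smul_const (unitPar e)).const_add y
    · rw [h.gradPos_hamP]
      have : inner ℝ (y + ((γ t).1 - (γ 0).1) • unitPar e) (unitPar e) = (γ t).1 := by
        rw [inner_add_left, real_inner_smul_left, hu, h0]
        ring
      rw [this, ← neg_smul]
      have hd : HasDerivAt (fun t => (γ t).2) (-f (γ t).1) t := (hγ t).snd
      exact ((hd.sub_const _).smul_const (unitPar e)).const_add ξ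
  · rintro c ⟨X, Ξ, hc⟩ hc0
    have h0' := (hc 0).1.symm.trans hc0
    rw [Prod.mk.injEq] at h0'
    obtain ⟨k, hk⟩ := (toTorus_eq_iff _ _).1 h0'.1
    have hX : ∀ t, HasDerivAt X (inner ℝ (Ξ t) (unitPar e) • unitPar e) t := fun t => by
      have := (hc t).2.1
      rwa [(hc t).1, gradMom_hamP] at this
    have hΞ : ∀ t, HasDerivAt Ξ ((-f (inner ℝ (X t) (unitPar e))) • unitPar e) t := fun t => by
      have := (hc t).2.2
      rwa [(hc t).1, h.gradPos_hamP, ← neg_smul] at this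
    have hXi : ∀ t, HasDerivAt (fun t => inner ℝ (X t) (unitPar e))
        (inner ℝ (Ξ t) (unitPar e)) t := fun t => by
      have := (hX t).inner ℝ (hasDerivAt_const t (unitPar e))
      simpa only [real_inner_smul_left, hu, mul_one, inner_zero_right, zero_add] using this
    have hΞi : ∀ t, HasDerivAt (fun t => inner ℝ (Ξ t) (unitPar e))
        (-f (inner ℝ (X t) (unitPar e))) t := fun t => by
      have := (hΞ t).inner ℝ (hasDerivAt_const t (unitPar e))
      simpa only [real_inner_smul_left, hu, mul_one, inner_zero_right, zero_add] using this
    obtain ⟨K, hK⟩ := h.lipschitz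
    have hδ : IsNewtonCurve f
        (fun t => (inner ℝ (X t) (unitPar e), inner ℝ (Ξ t) (unitPar e))) :=
      fun t => (hXi t).prodMk (hΞi t)
    have hγk : IsNewtonCurve f (fun t => γ t + (inner ℝ (vec k) (unitPar e), 0)) := fun t => by
      have := (hγ t).add_const ((inner ℝ (vec k) (unitPar e), 0) : ℝ × ℝ)
      simpa [h.apply_add_inner_vec he] using this
    have huniq := hδ.unique hK hγk (by simp [h0, hk, h0'.2, inner_add_left])
    have e1 := eq_add_smul_of_hasDerivAt hX hXi t
    have e2 := eq_add_smul_of_hasDerivAt hΞ hΞi t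
    have u1 : ∀ t, inner ℝ (X t) (unitPar e) = (γ t).1 + inner ℝ (vec k) (unitPar e) :=
      fun t => congrArg Prod.fst (congrFun huniq t)
    have u2 : ∀ t, inner ℝ (Ξ t) (unitPar e) = (γ t).2 := fun t => by
      simpa using congrArg Prod.snd (congrFun huniq t)
    rw [u1, u1, hk, add_sub_add_right_eq_sub] at e1
    rw [u2, u2, h0'.2] at e2
    rw [(hc t).1, e1, e2, add_right_comm, toTorus_add_vec]

/-! ### The action of ℝ² and its orbits. -/

theorem IsProfile.orbitMap_eq (h : IsProfile e V W f) (he : e ≠ 0) {γ : ℝ → ℝ × ℝ}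
    (hγ : IsNewtonCurve f γ) {y ξ : Plane}
    (h0 : γ 0 = (inner ℝ y (unitPar e), inner ℝ ξ (unitPar e))) (p : ℝ × ℝ) :
    orbitMap e V (toTorus y, ξ) p =
      (toTorus (y + ((γ p.2).1 - (γ 0).1) • unitPar e + p.1 • unitPerp e),
        ξ + ((γ p.2).2 - (γ 0).2) • unitPar e) := by
  rw [orbitMap, h.hamiltonianFlow_hamP he hγ h0, hamiltonianFlow_hamPerp]

/-- Every point of phase space has a lift to the plane and a solution of Newton's equation that
describes its orbit. -/
theorem IsProfile.exists_lift (h : IsProfile e V W f) (z : Phase) :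
    ∃ (y ξ : Plane) (γ : ℝ → ℝ × ℝ), z = (toTorus y, ξ) ∧ IsNewtonCurve f γ ∧
      γ 0 = (inner ℝ y (unitPar e), inner ℝ ξ (unitPar e)) := by
  obtain ⟨y, hy⟩ := toTorus_surjective z.1
  obtain ⟨K, hK⟩ := h.lipschitz
  obtain ⟨γ, hγ, h0⟩ := exists_isNewtonCurve hK h.contDiff
    (inner ℝ y (unitPar e), inner ℝ z.2 (unitPar e))
  exact ⟨y, z.2, γ, by rw [hy], hγ, h0⟩

theorem IsProfile.continuous_orbitMap (h : IsProfile e V W f) (he : e ≠ 0) (z : Phase) :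
    Continuous (orbitMap e V z) := by
  obtain ⟨y, ξ, γ, rfl, hγ, h0⟩ := h.exists_lift z
  rw [funext (h.orbitMap_eq he hγ h0)]
  have hc := hγ.continuous
  exact (continuous_toTorus.comp (by fun_prop)).prodMk (by fun_prop)

theorem IsProfile.orbitMap_zero (h : IsProfile e V W f) (he : e ≠ 0) (z : Phase) :
    orbitMap e V z 0 = z := by
  obtain ⟨y, ξ, γ, rfl, hγ, h0⟩ := h.exists_lift z
  rw [h.orbitMap_eq he hγ h0]
  simp

/-- The Newton curve of a displaced point is the time shift of the original one, so the explicit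
formulas compose additively. -/
theorem IsProfile.orbitMap_add (h : IsProfile e V W f) (he : e ≠ 0) (z : Phase) (a b : ℝ × ℝ) :
    orbitMap e V z (a + b) = orbitMap e V (orbitMap e V z b) a := by
  obtain ⟨y, ξ, γ, rfl, hγ, h0⟩ := h.exists_lift z
  have hu := inner_unitPar_unitPar he
  rw [h.orbitMap_eq he hγ h0, h.orbitMap_eq he hγ h0,
    h.orbitMap_eq he (hγ.comp_add b.2) (by
      rw [inner_add_left, inner_add_left, inner_add_left, real_inner_smul_left,
        real_inner_smul_left, real_inner_smul_left, hu, inner_unitPerp_unitPar, h0, zero_add]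
      ext <;> simp)]
  simp only [Prod.fst_add, Prod.snd_add, zero_add]
  refine Prod.ext (congrArg toTorus ?_) ?_ <;> module

theorem IsProfile.moment_orbitMap (h : IsProfile e V W f) (he : e ≠ 0) (z : Phase) (a : ℝ × ℝ) :
    moment e V (orbitMap e V z a) = moment e V z := by
  obtain ⟨y, ξ, γ, rfl, hγ, h0⟩ := h.exists_lift z
  have hu := inner_unitPar_unitPar he
  have hE := hγ.energy_eq h.hasDerivAt a.2
  rw [h0] at hE
  rw [h.orbitMap_eq he hγ h0, h0]
  simp only [moment, hamP, hamPerp_eq, hamPar_eq, h.average_eq, inner_add_left,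
    real_inner_smul_left, hu, inner_unitPerp_unitPar, inner_unitPar_unitPerp, mul_zero, add_zero,
    mul_one, add_sub_cancel, hE]

theorem IsProfile.mem_regular_iff (h : IsProfile e V W f) (he : e ≠ 0) (y ξ : Plane) :
    (toTorus y, ξ) ∈ regular e V ↔
      inner ℝ ξ (unitPar e) ≠ 0 ∨ f (inner ℝ y (unitPar e)) ≠ 0 := by
  have hu : unitPar e ≠ 0 := fun h0 => by simpa [h0] using inner_unitPar_unitPar he
  have h1 := h.torusGradient_eq 0 y
  simp only [zero_add] at h1
  rw [regular, crit, mem_compl_iff, mem_ofPred, hamPar_eq, not_and_or]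
  simp only
  rw [h1, smul_eq_zero_iff_left hu]

/-- A Newton curve that reaches an equilibrium is constant by uniqueness, so it would have started
there. -/
theorem IsProfile.orbitMap_mem_regular (h : IsProfile e V W f) (he : e ≠ 0) {z : Phase}
    (hz : z ∈ regular e V) (a : ℝ × ℝ) : orbitMap e V z a ∈ regular e V := by
  obtain ⟨y, ξ, γ, rfl, hγ, h0⟩ := h.exists_lift z
  have hu := inner_unitPar_unitPar he
  obtain ⟨K, hK⟩ := h.lipschitz
  rw [h.mem_regular_iff he] at hz
  rw [h.orbitMap_eq he hγ h0, h.mem_regular_iff he]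
  simp only [inner_add_left, real_inner_smul_left, hu, inner_unitPerp_unitPar, h0, mul_zero,
    add_zero, mul_one, add_sub_cancel]
  by_contra! hcon
  have hconst : IsNewtonCurve f (fun _ => γ a.2) := fun t => by
    rw [hcon.1, hcon.2]
    rw [neg_zero]
    exact hasDerivAt_const t (γ a.2)
  have h1 := congrFun ((hγ.comp_add a.2).unique hK hconst (by simp)) (-a.2)
  simp only [neg_add_cancel, h0] at h1
  rw [← h1] at hcon
  exact hz.elim (fun h => h hcon.1) (fun h => h hcon.2)

theorem IsProfile.orbitMap_mem_levelSet (h : IsProfile e V W f) (he : e ≠ 0) {z : Phase}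
    {m : ℝ × ℝ} (hz : z ∈ levelSet e V m) (a : ℝ × ℝ) : orbitMap e V z a ∈ levelSet e V m :=
  ⟨h.orbitMap_mem_regular he hz.1 a, (h.moment_orbitMap he z a).trans hz.2⟩

/-- Orbits are relatively open in the level sets of the moment map. -/
theorem IsProfile.image_orbitMap_mem_nhdsWithin (h : IsProfile e V W f) (he : e ≠ 0) {z : Phase}
    {m : ℝ × ℝ} (hz : z ∈ levelSet e V m) {T : Set (ℝ × ℝ)} (hT : T ∈ 𝓝 (0 : ℝ × ℝ)) :
    orbitMap e V z '' T ∈ 𝓝[levelSet e V m] z := by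
  obtain ⟨y, ξ, γ, rfl, hγ, h0⟩ := h.exists_lift z
  have hne := (h.mem_regular_iff he y ξ).1 hz.1
  obtain ⟨T1, hT1, T2, hT2, hTT⟩ := mem_nhds_prod_iff.1 hT
  have hev := hγ.eventually_mem_image h.hasDerivAt h.contDiff.continuous
    (by rw [h0]; exact hne) hT2
  have hc : Tendsto (fun p : Plane × Plane =>
      ((inner ℝ p.1 (unitPar e), inner ℝ p.2 (unitPar e)) : ℝ × ℝ)) (𝓝 (y, ξ)) (𝓝 (γ 0)) := by
    rw [h0]
    exact Continuous.tendsto' (by fun_prop) _ _ rfl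
  have hc2 : Tendsto (fun p : Plane × Plane => inner ℝ (p.1 - y) (unitPerp e)) (𝓝 (y, ξ))
      (𝓝 0) := Continuous.tendsto' (by fun_prop) _ _ (by simp)
  have hU := (hc.eventually hev).and (hc2.eventually hT1)
  obtain ⟨U1, hU1, U2, hU2, hUU⟩ := mem_nhds_prod_iff.1 hU
  refine mem_nhdsWithin_iff_exists_mem_nhds_inter.2
    ⟨(toTorus '' U1) ×ˢ U2, prod_mem_nhds (isOpenMap_toTorus.image_mem_nhds hU1) hU2, ?_⟩
  rintro ⟨x', ξ'⟩ ⟨⟨⟨y', hy', rfl⟩, hξ'⟩, -, hm⟩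
  obtain ⟨g1, g2⟩ := hUU (mk_mem_prod hy' hξ')
  have hm' := hm.trans hz.2.symm
  simp only [moment, hamP, hamPerp_eq, hamPar_eq, h.average_eq, Prod.mk.injEq] at hm'
  obtain ⟨t, ht, hγt⟩ := g1 (by rw [h0]; exact hm'.2)
  refine ⟨(inner ℝ (y' - y) (unitPerp e), t), hTT (mk_mem_prod g2 ht), ?_⟩
  rw [h.orbitMap_eq he hγ h0, hγt, h0]
  refine Prod.ext (congrArg toTorus ?_) ?_
  · have h1 := eq_inner_smul_add he y
    have h2 := eq_inner_smul_add he y'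
    rw [inner_sub_left]
    linear_combination (norm := module) h1 - h2
  · have h1 := eq_inner_smul_add he ξ
    have h2 := eq_inner_smul_add he ξ'
    rw [hm'.1] at h2
    linear_combination (norm := module) h1 - h2

theorem IsProfile.mem_range_orbitMap (h : IsProfile e V W f) (he : e ≠ 0) (z : Phase) :
    z ∈ range (orbitMap e V z) := ⟨0, h.orbitMap_zero he z⟩

theorem IsProfile.range_orbitMap_eq (h : IsProfile e V W f) (he : e ≠ 0) {x z : Phase}
    (hx : x ∈ range (orbitMap e V z)) : range (orbitMap e V x) = range (orbitMap e V z) := by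
  obtain ⟨a, rfl⟩ := hx
  ext y
  constructor
  · rintro ⟨b, rfl⟩
    exact ⟨b + a, h.orbitMap_add he z b a⟩
  · rintro ⟨b, rfl⟩
    exact ⟨b - a, by rw [← h.orbitMap_add he, sub_add_cancel]⟩

theorem IsProfile.range_orbitMap_mem_nhdsWithin (h : IsProfile e V W f) (he : e ≠ 0) {z : Phase}
    {m : ℝ × ℝ} (hz : z ∈ levelSet e V m) : range (orbitMap e V z) ∈ 𝓝[levelSet e V m] z := by
  rw [← image_univ]
  exact h.image_orbitMap_mem_nhdsWithin he hz univ_mem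

/-- The orbits partition the level set into relatively open, hence relatively clopen, sets, and each
is connected as a continuous image of ℝ². -/
theorem IsProfile.component_eq (h : IsProfile e V W f) (he : e ≠ 0) {z : Phase}
    (hz : z ∈ regular e V) : component e V z = range (orbitMap e V z) := by
  have hzL : z ∈ levelSet e V (moment e V z) := ⟨hz, rfl⟩
  apply Subset.antisymm
  · set L := levelSet e V (moment e V z)
    set O := range (orbitMap e V z)
    have hCL : component e V z ⊆ L := connectedComponentIn_subset _ _
    have hpre : IsPreconnected (component e V z) := isPreconnected_connectedComponentIn
    have hzC : z ∈ component e V z := mem_connectedComponentIn hzL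
    -- Adjoining the complement of L turns relatively open subsets of L into ambient neighbourhoods.
    have key : ∀ x ∈ L, x ∈ interior (O ∪ Lᶜ) ∪ interior (Oᶜ ∪ Lᶜ) := by
      intro x hx
      have h1 := h.range_orbitMap_mem_nhdsWithin he hx
      rw [mem_nhdsWithin_iff_eventually] at h1
      by_cases hxO : x ∈ O
      · left
        rw [h.range_orbitMap_eq he hxO] at h1
        rw [mem_interior_iff_mem_nhds]
        filter_upwards [h1] with y hy
        by_cases hyL : y ∈ L
        · exact Or.inl (hy hyL)
        · exact Or.inr hyL
      · right
        rw [mem_interior_iff_mem_nhds]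
        filter_upwards [h1] with y hy
        by_cases hyL : y ∈ L
        · refine Or.inl fun hyO => hxO ?_
          have e1 := h.range_orbitMap_eq he (hy hyL)
          have e2 := h.range_orbitMap_eq he hyO
          change x ∈ range (orbitMap e V z)
          rw [← e2, e1]
          exact h.mem_range_orbitMap he x
        · exact Or.inr hyL
    rcases isPreconnected_iff_subset_of_disjoint.1 hpre _ _ isOpen_interior isOpen_interior
      (fun x hx => key x (hCL hx)) (by
        ext x
        simp only [mem_inter_iff, mem_empty_iff_false, iff_false, not_and]
        intro hx h1 h2
        have hxL := hCL hx
        rcases interior_subset h1 with h1 | h1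
        · rcases interior_subset h2 with h2 | h2
          · exact h2 h1
          · exact h2 hxL
        · exact h1 hxL) with h1 | h1
    · intro x hx
      exact (interior_subset (h1 hx)).resolve_right fun hn => hn (hCL hx)
    · exact absurd (h.mem_range_orbitMap he z)
        ((interior_subset (h1 hzC)).resolve_right fun hn => hn hzL)
  · exact (isPreconnected_range (h.continuous_orbitMap he z)).subset_connectedComponentIn
      (h.mem_range_orbitMap he z)
      (range_subset_iff.2 fun a => h.orbitMap_mem_levelSet he hzL a)

/-! ### Orbits as quotients of ℝ² by period groups. -/

theorem IsProfile.sub_mem_periodGroup (h : IsProfile e V W f) (he : e ≠ 0) {z : Phase}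
    {a b : ℝ × ℝ} (hab : orbitMap e V z a = orbitMap e V z b) : -a + b ∈ periodGroup e V z := by
  intro w
  rw [show -a + b + w = (w - a) + b by abel, h.orbitMap_add he, ← hab, ← h.orbitMap_add he,
    sub_add_cancel]

theorem IsProfile.isClosed_periodGroup (h : IsProfile e V W f) (he : e ≠ 0) (z : Phase) :
    IsClosed (periodGroup e V z : Set (ℝ × ℝ)) := by
  have : (periodGroup e V z : Set (ℝ × ℝ)) = orbitMap e V z ⁻¹' {z} := by
    ext a
    constructor
    · intro ha
      have := ha 0
      rwa [add_zero, h.orbitMap_zero he] at this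
    · intro ha
      have : orbitMap e V z 0 = orbitMap e V z a := (h.orbitMap_zero he z).trans ha.symm
      simpa using h.sub_mem_periodGroup he this
  rw [this]
  exact isClosed_singleton.preimage (h.continuous_orbitMap he z)

theorem torusMap_mk (z : Phase) (a : ℝ × ℝ) :
    torusMap e V z (QuotientAddGroup.mk a) = orbitMap e V z a := rfl

theorem range_torusMap (z : Phase) : range (torusMap e V z) = range (orbitMap e V z) := by
  ext x
  constructor
  · rintro ⟨q, rfl⟩
    obtain ⟨a, rfl⟩ := QuotientAddGroup.mk_surjective q
    exact ⟨a, rfl⟩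
  · rintro ⟨a, rfl⟩
    exact ⟨QuotientAddGroup.mk a, rfl⟩

theorem IsProfile.injective_torusMap (h : IsProfile e V W f) (he : e ≠ 0) (z : Phase) :
    Function.Injective (torusMap e V z) := by
  intro p q hpq
  obtain ⟨a, rfl⟩ := QuotientAddGroup.mk_surjective p
  obtain ⟨b, rfl⟩ := QuotientAddGroup.mk_surjective q
  exact QuotientAddGroup.eq.2 (h.sub_mem_periodGroup he hpq)

theorem IsProfile.continuous_torusMap (h : IsProfile e V W f) (he : e ≠ 0) (z : Phase) :
    Continuous (torusMap e V z) :=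
  continuous_quot_lift _ (h.continuous_orbitMap he z)

theorem IsProfile.measurableSet_range_orbitMap (h : IsProfile e V W f) (he : e ≠ 0) (z : Phase) :
    MeasurableSet (range (orbitMap e V z)) := by
  rw [← image_univ, ← Metric.iUnion_closedBall_nat (0 : ℝ × ℝ), image_iUnion]
  exact MeasurableSet.iUnion fun n =>
    ((isCompact_closedBall _ _).image (h.continuous_orbitMap he z)).isClosed.measurableSet

theorem IsProfile.measurableEmbedding_torusMap (h : IsProfile e V W f) (he : e ≠ 0) (z : Phase) :
    MeasurableEmbedding (torusMap e V z) := by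
  have hm : Measurable (orbitMap e V z) := (h.continuous_orbitMap he z).measurable
  have hr := h.measurableSet_range_orbitMap he z
  refine ⟨h.injective_torusMap he z, ?_, fun {S} hS => ?_⟩
  · exact measurable_from_quotient.2 hm
  · have h1 : MeasurableSet (orbitMap e V z ⁻¹' (torusMap e V z '' S)) := by
      have : orbitMap e V z ⁻¹' (torusMap e V z '' S) = QuotientAddGroup.mk ⁻¹' S := by
        ext a
        rw [mem_preimage, ← torusMap_mk, (h.injective_torusMap he z).mem_set_image]
        rfl
      rw [this]
      exact measurableSet_quotient.1 hS
    -- As ℝ² is standard Borel and the range is measurable, measurability of a preimage passes to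
    -- the trace on the range; no continuous inverse is needed.
    rw [hm.measurableSet_preimage_iff_inter_range hr] at h1
    rwa [← range_torusMap, inter_eq_left.2 (image_subset_range _ _)] at h1

theorem IsProfile.isCompact_component (h : IsProfile e V W f) (he : e ≠ 0) {z : Phase}
    (hz : z ∈ regular e V) [CompactSpace ((ℝ × ℝ) ⧸ periodGroup e V z)] :
    IsCompact (component e V z) := by
  rw [h.component_eq he hz, ← range_torusMap]
  exact isCompact_range (h.continuous_torusMap he z)

/-- Finitely many orbit pieces, images of the closed unit ball, cover the compact orbit; pulled
back, finitely many translated balls cover the quotient. -/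
theorem IsProfile.compactSpace_quotient (h : IsProfile e V W f) (he : e ≠ 0) {z : Phase}
    (hz : z ∈ compactPart e V) : CompactSpace ((ℝ × ℝ) ⧸ periodGroup e V z) := by
  have hc := hz.2
  rw [h.component_eq he hz.1] at hc
  set L := levelSet e V (moment e V z)
  have hzL : z ∈ L := ⟨hz.1, rfl⟩
  have hOL : range (orbitMap e V z) ⊆ L :=
    range_subset_iff.2 fun a => h.orbitMap_mem_levelSet he hzL a
  obtain ⟨t, ht, htc⟩ := hc.elim_nhdsWithin_subcover
    (fun x => orbitMap e V x '' Metric.closedBall 0 1) (fun x hx =>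
      nhdsWithin_mono x hOL (h.image_orbitMap_mem_nhdsWithin he (hOL hx)
        (Metric.closedBall_mem_nhds 0 one_pos)))
  choose! a ha using ht
  have hK : IsCompact (⋃ x ∈ t, (fun b => b + a x) '' Metric.closedBall (0 : ℝ × ℝ) 1) :=
    t.isCompact_biUnion fun x _ => (isCompact_closedBall _ _).image (by fun_prop)
  refine ⟨?_⟩
  convert hK.image (QuotientAddGroup.continuous_mk (N := periodGroup e V z)) using 1
  refine (eq_univ_of_forall fun q => ?_).symm
  obtain ⟨b, rfl⟩ := QuotientAddGroup.mk_surjective q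
  obtain ⟨x, hx, c, hc, hcb⟩ := mem_iUnion₂.1 (htc ⟨b, rfl⟩)
  refine ⟨c + a x, mem_iUnion₂.2 ⟨x, hx, c, hc, rfl⟩, h.injective_torusMap he z ?_⟩
  rw [torusMap_mk, torusMap_mk, h.orbitMap_add he, ha x hx]
  exact hcb

theorem IsProfile.exists_isTorusHaar (h : IsProfile e V W f) (he : e ≠ 0) {z : Phase}
    (hz : z ∈ compactPart e V) : ∃ m, IsTorusHaar e V z m := by
  have := h.compactSpace_quotient he hz
  have : IsClosed (periodGroup e V z : Set (ℝ × ℝ)) := h.isClosed_periodGroup he z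
  exact ⟨_, Measure.addHaarMeasure ⊤, inferInstance,
    ⟨Measure.addHaarMeasure_self⟩, rfl⟩

/-! ### Invariant measures on a single level set. -/

/-- A finite measure that is invariant under the action of `ℝ²` and charges an orbit restricts to
a multiple of the Haar measure on this orbit, which is a torus. -/
theorem IsProfile.isTorusHaar_of_invariant (h : IsProfile e V W f) (he : e ≠ 0) {z : Phase}
    {m : Measure Phase} [IsFiniteMeasure m]
    (hinv : ∀ a, MeasurePreserving (fun x => orbitMap e V x a) m m)
    (hpos : m (range (orbitMap e V z)) ≠ 0) :
    CompactSpace ((ℝ × ℝ) ⧸ periodGroup e V z) ∧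
      IsTorusHaar e V z
        ((m (range (orbitMap e V z)))⁻¹ • m.restrict (range (orbitMap e V z))) := by
  have hcl : IsClosed (periodGroup e V z : Set (ℝ × ℝ)) := h.isClosed_periodGroup he z
  set c := m (range (orbitMap e V z)) with hc
  have hctop : c ≠ ⊤ := measure_ne_top m _
  have hF := h.measurableEmbedding_torusMap he z
  set ν : Measure ((ℝ × ℝ) ⧸ periodGroup e V z) := c⁻¹ • m.comap (torusMap e V z) with hν
  have hprob : IsProbabilityMeasure ν := ⟨by
    rw [hν, Measure.smul_apply, hF.comap_apply, image_univ, range_torusMap, smul_eq_mul,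
      ENNReal.inv_mul_cancel hpos hctop]⟩
  have hinvν : ν.IsAddLeftInvariant := ⟨fun g => by
    obtain ⟨a, rfl⟩ := QuotientAddGroup.mk_surjective g
    ext A hA
    rw [Measure.map_apply (measurable_const_add _) hA, hν, Measure.smul_apply,
      Measure.smul_apply, hF.comap_apply, hF.comap_apply,
      ← (hinv a).measure_preimage (hF.measurableSet_image.2 hA).nullMeasurableSet]
    congr 2
    have hshift : ∀ q, torusMap e V z (QuotientAddGroup.mk a + q) =
        orbitMap e V (torusMap e V z q) a := fun q => by
      obtain ⟨b, rfl⟩ := QuotientAddGroup.mk_surjective q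
      exact h.orbitMap_add he z a b
    ext x
    constructor
    · rintro ⟨q, hq, rfl⟩
      exact ⟨_, hq, hshift q⟩
    · rintro ⟨q, hq, hqx⟩
      refine ⟨-QuotientAddGroup.mk a + q, by simpa using hq, ?_⟩
      have h1 := hshift (-QuotientAddGroup.mk a + q)
      rw [add_neg_cancel_left, hqx] at h1
      have h2 := congrArg (fun x => orbitMap e V x (-a)) h1
      simpa only [← h.orbitMap_add he, neg_add_cancel, h.orbitMap_zero he] using h2.symm⟩
  -- A compact set of positive mass is what makes a nonzero invariant measure positive on open sets.
  obtain ⟨n, hn⟩ : ∃ n : ℕ, ν ((fun a : ℝ × ℝ => (QuotientAddGroup.mk a :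
      (ℝ × ℝ) ⧸ periodGroup e V z)) '' Metric.closedBall 0 n) ≠ 0 := by
    by_contra! hcon
    have := measure_iUnion_null hcon
    rw [← image_iUnion, Metric.iUnion_closedBall_nat, image_univ,
      QuotientAddGroup.mk_surjective.range_eq, measure_univ] at this
    exact one_ne_zero this
  have hop : ν.IsOpenPosMeasure := isOpenPosMeasure_of_addLeftInvariant_of_compact _
    ((isCompact_closedBall _ _).image QuotientAddGroup.continuous_mk) hn
  have hhaar : ν.IsAddHaarMeasure :=
    { lt_top_of_isCompact := fun K _ => measure_lt_top ν K }
  refine ⟨?_, ν, hhaar, hprob, ?_⟩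
  -- On a noncompact group such an invariant measure would have infinite total mass.
  · by_contra hcon
    have := not_compactSpace_iff.1 hcon
    have h1 := measure_univ_of_isAddLeftInvariant ν
    rw [measure_univ] at h1
    exact ENNReal.one_ne_top h1
  · rw [hν, Measure.map_smul, hF.map_comap, range_torusMap]

theorem IsConvexCombOfTori.mem_image {p : ℝ × ℝ} {m : Measure Phase}
    (hm : IsConvexCombOfTori e V p m) : p ∈ moment e V '' compactPart e V := by
  obtain ⟨z, -, -, hz, -⟩ := hm
  exact ⟨z 0, (hz 0).2, (hz 0).1.2⟩

theorem isConvexCombOfTori_of_isTorusHaar {z : Phase} (hz : z ∈ compactPart e V)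
    {m : Measure Phase} (hm : IsTorusHaar e V z m) :
    IsConvexCombOfTori e V (moment e V z) m := by
  refine ⟨fun _ => z, fun n => if n = 0 then 1 else 0, fun _ => m,
    fun _ => ⟨⟨hz.1, rfl⟩, hz⟩, fun _ => hm, by simp, ?_⟩
  ext s hs
  rw [Measure.sum_apply _ hs, tsum_eq_single 0 (fun n hn => by simp [hn])]
  simp

/-- An invariant probability measure on a level set of the moment map is a convex combination of
Haar measures on invariant tori. -/
theorem IsProfile.isConvexCombOfTori (h : IsProfile e V W f) (he : e ≠ 0) {p : ℝ × ℝ}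
    {m : Measure Phase} [IsProbabilityMeasure m]
    (hinv : ∀ a, MeasurePreserving (fun x => orbitMap e V x a) m m)
    (hL : ∀ᵐ x ∂m, x ∈ levelSet e V p) : IsConvexCombOfTori e V p m := by
  obtain ⟨t, htL, htc, hcov⟩ := TopologicalSpace.countable_cover_nhdsWithin
    (f := fun x => range (orbitMap e V x)) (s := levelSet e V p)
    fun x hx => h.range_orbitMap_mem_nhdsWithin he hx
  obtain ⟨x0, hx0⟩ := hL.exists
  have htne : t.Nonempty := by
    obtain ⟨x, hx, -⟩ := mem_iUnion₂.1 (hcov hx0)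
    exact ⟨x, hx⟩
  obtain ⟨z, rfl⟩ := htc.exists_eq_range htne
  set O : ℕ → Set Phase := fun n => range (orbitMap e V (z n)) with hO
  have hOm : ∀ n, MeasurableSet (O n) := fun n => h.measurableSet_range_orbitMap he (z n)
  set A := disjointed O with hA
  have hAm : ∀ n, MeasurableSet (A n) := fun n => MeasurableSet.disjointed hOm n
  -- The enumeration may repeat orbits. Two orbits are equal or disjoint, so removing the earlier
  -- ones from an orbit leaves all of it or nothing.
  have hAO : ∀ n, m (A n) ≠ 0 → A n = O n := by
    intro n hn
    refine Subset.antisymm (disjointed_subset O n) ?_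
    obtain ⟨x, hx⟩ := nonempty_of_measure_ne_zero hn
    rw [hA, disjointed_eq_inter_compl] at hx ⊢
    refine fun y hy => ⟨hy, mem_iInter₂.2 fun k hk hyk => mem_iInter₂.1 hx.2 k hk ?_⟩
    have e1 := h.range_orbitMap_eq he hy
    have e2 := h.range_orbitMap_eq he hyk
    have hxn := hx.1
    simp only [hO] at hxn ⊢
    rwa [← e2, e1]
  have hsum : m = Measure.sum fun n => m.restrict (A n) := by
    rw [← Measure.restrict_iUnion (disjoint_disjointed O) hAm, iUnion_disjointed,
      Measure.restrict_eq_self_of_ae_mem]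
    filter_upwards [hL] with x hx
    simpa [hO] using hcov hx
  have htot : ∑' n, m (A n) = 1 := by
    have := congrArg (fun ν : Measure Phase => ν univ) hsum
    simp only [measure_univ, Measure.sum_apply _ MeasurableSet.univ,
      Measure.restrict_apply_univ] at this
    exact this.symm
  obtain ⟨k, hk⟩ : ∃ k, m (A k) ≠ 0 := by
    by_contra! hcon
    simp [hcon] at htot
  -- Terms of weight zero must still carry a genuine compact torus; the charged index k supplies
  -- one.
  set j : ℕ → ℕ := fun n => if m (A n) = 0 then k else n with hj
  have hjm : ∀ n, m (A (j n)) ≠ 0 := by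
    intro n
    by_cases hn : m (A n) = 0 <;> simp [hj, hn, hk]
  have hH : ∀ n, CompactSpace ((ℝ × ℝ) ⧸ periodGroup e V (z (j n))) ∧
      IsTorusHaar e V (z (j n)) ((m (O (j n)))⁻¹ • m.restrict (O (j n))) := fun n => by
    have := hjm n
    rw [hAO _ this] at this
    exact h.isTorusHaar_of_invariant he hinv this
  refine ⟨fun n => z (j n), fun n => m (A n), _, fun n => ?_, fun n => (hH n).2, htot, ?_⟩
  · have hz := htL (mem_range_self (j n))
    have := (hH n).1
    exact ⟨hz, hz.1, h.isCompact_component he hz.1⟩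
  · conv_lhs => rw [hsum]
    congr 1
    funext n
    by_cases hn : m (A n) = 0
    · simp only [hn, zero_smul, Measure.restrict_eq_zero.2 hn]
    · have hjn : j n = n := by simp [hj, hn]
      beta_reduce
      rw [hjn, ← hAO n hn, smul_smul, ENNReal.mul_inv_cancel hn (measure_ne_top m _), one_smul]

end Dynamics

/-! ### Conditioning on the moment map. -/

section Disintegration

open Filter Topology ProbabilityTheory

variable {e : Fin 2 → ℤ} {V : Torus → ℝ} {W f : ℝ → ℝ}

/-- The conditional distribution given an invariant function inherits the invariance under a
measure-preserving map almost surely. -/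
theorem ae_measurePreserving_condDistrib {α β : Type*} [MeasurableSpace α] [StandardBorelSpace α]
    [Nonempty α] [MeasurableSpace β] {μ : Measure α} [IsFiniteMeasure μ] {X : α → β}
    (hX : Measurable X) {T : α → α} (hT : MeasurePreserving T μ μ) (hXT : ∀ x, X (T x) = X x) :
    ∀ᵐ b ∂(μ.map X), MeasurePreserving T (condDistrib id X μ b) (condDistrib id X μ b) := by
  have h1 := condDistrib_comp (β := β) (mβ := inferInstance) X (μ := μ) (Y := id)
    aemeasurable_id hT.measurable
  -- Since X is T-invariant, (X, id) and (X, T) have the same law, and conditional kernels are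
  -- essentially unique.
  have h2 : condDistrib id X μ =ᵐ[μ.map X] condDistrib (T ∘ id) X μ := by
    refine condDistrib_ae_eq_of_measure_eq_compProd X aemeasurable_id ?_
    rw [compProd_map_condDistrib (hT.measurable.comp measurable_id).aemeasurable]
    conv_lhs => rw [← hT.map_eq]
    rw [Measure.map_map (hX.prodMk measurable_id) hT.measurable]
    congr 1
    funext x
    simp [hXT]
  filter_upwards [h1, h2] with b hb1 hb2
  refine ⟨hT.measurable, ?_⟩
  rw [hb1, Kernel.map_apply _ hT.measurable] at hb2
  exact hb2.symm

/-- Invariance under a continuous family of maps extends from a dense set of parameters. -/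
theorem measurePreserving_of_dense {α P : Type*} [TopologicalSpace α] [MeasurableSpace α]
    [BorelSpace α] [HasOuterApproxClosed α] [TopologicalSpace P] [FirstCountableTopology P]
    {m : Measure α} [IsFiniteMeasure m] {T : P → α → α} (hT : ∀ t, Measurable (T t))
    (hc : ∀ x, Continuous fun t => T t x) {D : Set P} (hD : Dense D)
    (hinv : ∀ t ∈ D, MeasurePreserving (T t) m m) (t : P) : MeasurePreserving (T t) m m := by
  refine ⟨hT t, ?_⟩
  have : IsFiniteMeasure (m.map (T t)) := Measure.isFiniteMeasure_map m _
  refine ext_of_forall_integral_eq_of_IsFiniteMeasure fun g => ?_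
  have hcont : Continuous fun t => ∫ x, g (T t x) ∂m := by
    refine continuous_of_dominated (bound := fun _ => ‖g‖)
      (fun t => (g.continuous.measurable.comp (hT t)).aestronglyMeasurable)
      (fun t => Eventually.of_forall fun x => g.norm_coe_le_norm _) (integrable_const _)
      (Eventually.of_forall fun x => g.continuous.comp (hc x))
  have heq : (fun t => ∫ x, g (T t x) ∂m) = fun _ => ∫ x, g x ∂m := by
    refine hcont.ext_on hD continuous_const fun s hs => ?_
    have := integral_map (μ := m) (hT s).aemeasurable (f := fun x => g x)
      g.continuous.measurable.aestronglyMeasurable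
    rw [(hinv s hs).map_eq] at this
    exact this.symm
  rw [integral_map (hT t).aemeasurable g.continuous.measurable.aestronglyMeasurable]
  exact congrFun heq t

theorem IsProfile.continuous_average (h : IsProfile e V W f) : Continuous (average e V) := by
  have hq : IsOpenQuotientMap toTorus :=
    ⟨toTorus_surjective, continuous_toTorus, isOpenMap_toTorus⟩
  rw [hq.isQuotientMap.continuous_iff]
  have hW : Continuous W := continuous_iff_continuousAt.2 fun q => (h.hasDerivAt q).continuousAt
  rw [show average e V ∘ toTorus = fun y => W (inner ℝ y (unitPar e)) from funext h.average_eq]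
  exact hW.comp (by fun_prop)

theorem IsProfile.continuous_moment (h : IsProfile e V W f) : Continuous (moment e V) := by
  have := h.continuous_average
  unfold moment hamP hamPerp hamPar
  fun_prop

theorem IsProfile.measurableSet_regular (h : IsProfile e V W f) (he : e ≠ 0) :
    MeasurableSet (regular e V) := by
  apply IsOpen.measurableSet
  rw [isOpen_iff_mem_nhds]
  rintro ⟨x, η⟩ hz
  obtain ⟨y, rfl⟩ := toTorus_surjective x
  have hev : ∀ᶠ p : Plane × Plane in 𝓝 (y, η), (toTorus p.1, p.2) ∈ regular e V := by
    simp only [h.mem_regular_iff he] at hz ⊢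
    have hf := h.contDiff.continuous
    rcases hz with hz | hz
    · have hc : Continuous fun p : Plane × Plane => inner ℝ p.2 (unitPar e) := by fun_prop
      filter_upwards [hc.continuousAt.eventually_ne hz] with p hp using Or.inl hp
    · have hc : Continuous fun p : Plane × Plane => f (inner ℝ p.1 (unitPar e)) := by fun_prop
      filter_upwards [hc.continuousAt.eventually_ne hz] with p hp using Or.inr hp
  obtain ⟨U1, hU1, U2, hU2, hUU⟩ := mem_nhds_prod_iff.1 hev
  refine mem_of_superset (prod_mem_nhds (isOpenMap_toTorus.image_mem_nhds hU1) hU2) ?_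
  rintro ⟨x, ξ⟩ ⟨⟨y', hy', rfl⟩, hξ⟩
  exact hUU (mk_mem_prod hy' hξ)

/-- Disintegration along the moment map of an invariant measure. -/
theorem IsProfile.ae_condDistrib (h : IsProfile e V W f) (he : e ≠ 0) {μ : Measure Phase}
    [IsProbabilityMeasure μ] (hμR : μ (regular e V)ᶜ = 0)
    (hinv : ∀ a, MeasurePreserving (fun x => orbitMap e V x a) μ μ) :
    ∀ᵐ p ∂(μ.map (moment e V)),
      (∀ a, MeasurePreserving (fun x => orbitMap e V x a)
        (condDistrib id (moment e V) μ p) (condDistrib id (moment e V) μ p)) ∧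
      ∀ᵐ x ∂(condDistrib id (moment e V) μ p), x ∈ levelSet e V p := by
  have hX : Measurable (moment e V) := h.continuous_moment.measurable
  -- Each parameter has its own exceptional null set; a countable dense set of parameters keeps
  -- their union null, and continuity does the rest.
  obtain ⟨D, hDc, hDd⟩ := TopologicalSpace.exists_countable_dense (ℝ × ℝ)
  have h1 : ∀ᵐ p ∂(μ.map (moment e V)), ∀ a ∈ D, MeasurePreserving (fun x => orbitMap e V x a)
      (condDistrib id (moment e V) μ p) (condDistrib id (moment e V) μ p) :=
    (ae_ball_iff hDc).2 fun a _ =>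
      ae_measurePreserving_condDistrib hX (hinv a) fun x => h.moment_orbitMap he x a
  have h2 : ∀ᵐ q ∂((μ.map (moment e V)) ⊗ₘ condDistrib id (moment e V) μ),
      q.2 ∈ levelSet e V q.1 := by
    have hms : MeasurableSet {q : (ℝ × ℝ) × Phase | q.2 ∈ levelSet e V q.1} :=
      (measurable_snd (h.measurableSet_regular he)).inter
        (measurableSet_eq_fun (hX.comp measurable_snd) measurable_fst)
    rw [compProd_map_condDistrib aemeasurable_id,
      ae_map_iff (hX.prodMk measurable_id).aemeasurable hms]
    have : ∀ᵐ x ∂μ, x ∈ regular e V := hμR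
    filter_upwards [this] with x hx using ⟨hx, rfl⟩
  filter_upwards [h1, Measure.ae_ae_of_ae_compProd h2] with p hp1 hp2
  exact ⟨measurePreserving_of_dense (fun a => (hinv a).measurable)
    (fun x => h.continuous_orbitMap he x) hDd hp1, hp2⟩

/-! ### Arcs are null, and the final assembly. -/

theorem ne_zero_of_isPrimitiveRankOne {Λ : AddSubgroup (Fin 2 → ℤ)} (hΛ : IsPrimitiveRankOne Λ)
    (he : AddSubgroup.zmultiples e = Λ) : e ≠ 0 := by
  rintro rfl
  have h := hΛ.1
  have hv : vec 0 = 0 := by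
    ext i
    fin_cases i <;> simp [vec]
  rw [← he, AddSubgroup.zmultiples_zero_eq_bot, AddSubgroup.coe_bot, image_singleton, hv,
    Submodule.span_zero_singleton, finrank_bot] at h
  exact zero_ne_one h

/-- An arc of an orbit of `H_Λ^⊥` in the regular part is a null set of every finite measure that is
invariant under the action of `ℝ²`. -/
theorem IsProfile.measure_arc_eq_zero (h : IsProfile e V W f) (he : e ≠ 0) {μ : Measure Phase}
    [IsFiniteMeasure μ] (hinv : ∀ a, MeasurePreserving (fun x => orbitMap e V x a) μ μ)
    {z : Phase} (hz : z ∈ regular e V) {S : Set ℝ} (hS : IsCompact S) :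
    μ ((fun s => orbitMap e V z (s, 0)) '' S) = 0 := by
  obtain ⟨y, ξ, γ, rfl, hγ, h0⟩ := h.exists_lift z
  have hu := inner_unitPar_unitPar he
  have hl := len_pos he
  -- The spacing is 1/`len e` because the component of an integer vector along `unitPar` is an
  -- integer multiple of it.
  obtain ⟨T, hT, hinj⟩ := hγ.exists_injOn h.contDiff.continuous
    (by rw [h0]; exact (h.mem_regular_iff he y ξ).1 hz) (one_div_pos.2 hl)
  set C := (fun s => orbitMap e V (toTorus y, ξ) (s, 0)) '' S with hC
  have hCm : MeasurableSet C := (hS.image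
    ((h.continuous_orbitMap he _).comp (by fun_prop : Continuous fun s : ℝ => (s, (0 : ℝ)))))
      |>.isClosed.measurableSet
  have hpre : ∀ t x, x ∈ (fun x => orbitMap e V x (0, -t)) ⁻¹' C →
      ∃ s, x = orbitMap e V (toTorus y, ξ) (s, t) := by
    rintro t x ⟨s, -, hs⟩
    refine ⟨s, ?_⟩
    have h1 := congrArg (fun x => orbitMap e V x (0, t)) hs
    simp only [← h.orbitMap_add he] at h1
    have h2 : ((0, t) + (0, -t) : ℝ × ℝ) = 0 := by simp
    rw [h2, h.orbitMap_zero he] at h1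
    simpa using h1.symm
  have hdisj : ∀ t ∈ T, ∀ t' ∈ T, t ≠ t' →
      Disjoint ((fun x => orbitMap e V x (0, -t)) ⁻¹' C)
        ((fun x => orbitMap e V x (0, -t')) ⁻¹' C) := by
    intro t ht t' ht' hne
    rw [Set.disjoint_left]
    intro x hx hx'
    obtain ⟨s, rfl⟩ := hpre t x hx
    obtain ⟨s', hs'⟩ := hpre t' _ hx'
    rw [h.orbitMap_eq he hγ h0, h.orbitMap_eq he hγ h0, Prod.mk.injEq, toTorus_eq_iff] at hs'
    obtain ⟨⟨k, hk⟩, hξ⟩ := hs'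
    have e1 := congrArg (fun v => inner ℝ v (unitPar e)) hk
    have e2 := congrArg (fun v => inner ℝ v (unitPar e)) hξ
    simp only [inner_add_left, real_inner_smul_left, hu, inner_unitPerp_unitPar, mul_zero,
      add_zero, mul_one] at e1 e2
    have e3 : inner ℝ (vec k) (unitPar e) = ((k 0 * e 0 + k 1 * e 1 : ℤ) : ℝ) * (1 / len e) := by
      rw [inner_plane, (unitPar_apply e).1, (unitPar_apply e).2]
      simp only [vec]
      push_cast
      simp
      ring
    exact hne (hinj t ht t' ht' (k 0 * e 0 + k 1 * e 1) (by rw [← e3]; linarith) (by linarith))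
  have hinf : T.Infinite := infinite_of_mem_nhds 0 hT
  set τ : ℕ ↪ T := hinf.natEmbedding
  have hsum : ∑' n, μ ((fun x => orbitMap e V x (0, -(τ n : ℝ))) ⁻¹' C) ≤ μ univ :=
    (tsum_meas_le_meas_iUnion_of_disjoint μ (fun n => (hinv _).measurable hCm)
      (fun n m hnm => hdisj _ (τ n).2 _ (τ m).2
        fun heq => hnm (τ.injective (Subtype.ext heq)))).trans (measure_mono (subset_univ _))
  simp only [fun a => (hinv a).measure_preimage hCm.nullMeasurableSet] at hsum
  by_contra hne
  rw [ENNReal.tsum_const_eq_top_of_ne_zero hne] at hsum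
  exact measure_ne_top μ univ (top_le_iff.1 hsum)

theorem IsProfile.orbitMap_fst (h : IsProfile e V W f) (he : e ≠ 0) (z : Phase) (s : ℝ) :
    orbitMap e V z (s, 0) = hamiltonianFlow (hamPerp e) s z := by
  obtain ⟨y, ξ, γ, rfl, hγ, h0⟩ := h.exists_lift z
  rw [h.orbitMap_eq he hγ h0, hamiltonianFlow_hamPerp]
  simp

theorem integral_condDistrib_id {α β : Type*} [MeasurableSpace α] [StandardBorelSpace α]
    [Nonempty α] [MeasurableSpace β] {μ : Measure α} [IsFiniteMeasure μ] {X : α → β}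
    (hX : Measurable X) {a : α → ℝ} (ha : Integrable a μ) :
    Integrable (fun b => ∫ x, a x ∂(condDistrib id X μ b)) (μ.map X) ∧
      ∫ x, a x ∂μ = ∫ b, ∫ x, a x ∂(condDistrib id X μ b) ∂(μ.map X) := by
  have hp : Measurable fun x => (X x, id x) := hX.prodMk measurable_id
  have hsnd : (μ.map fun x => (X x, id x)).map Prod.snd = μ := by
    rw [Measure.map_map measurable_snd hp]
    exact Measure.map_id
  have hint : Integrable (fun q : β × α => a q.2) (μ.map fun x => (X x, id x)) :=
    Integrable.comp_measurable (g := a) (by rwa [hsnd]) measurable_snd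
  refine ⟨hint.integral_condDistrib_map aemeasurable_id, ?_⟩
  have h1 := hint
  rw [← compProd_map_condDistrib aemeasurable_id] at h1
  rw [← Measure.integral_compProd h1, compProd_map_condDistrib aemeasurable_id,
    integral_map hp.aemeasurable hint.1]
  rfl

open Classical in
/-- The disintegration of an invariant probability measure into convex combinations of Haar
measures on invariant tori. -/
theorem IsProfile.exists_disintegration (hprof : IsProfile e V W f) (he0 : e ≠ 0)
    {μ : Measure Phase} [IsProbabilityMeasure μ] (hμR : μ (regular e V)ᶜ = 0)
    (hinv : ∀ a, MeasurePreserving (fun x => orbitMap e V x a) μ μ) :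
    ∃ lam : ℝ × ℝ → Measure Phase,
      lam =ᵐ[μ.map (moment e V)] condDistrib id (moment e V) μ ∧
      (∀ p ∈ moment e V '' compactPart e V, IsConvexCombOfTori e V p (lam p)) ∧
      (∀ p, p ∉ moment e V '' compactPart e V → lam p = 0) ∧
      (∀ᵐ p ∂(μ.map (moment e V)), p ∈ moment e V '' compactPart e V) ∧
      ∀ᵐ p ∂(μ.map (moment e V)), ∀ᵐ x ∂(lam p), x ∈ levelSet e V p := by
  set κ := condDistrib id (moment e V) μ with hκ
  have hgood : ∀ᵐ p ∂(μ.map (moment e V)),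
      IsConvexCombOfTori e V p (κ p) ∧ ∀ᵐ x ∂(κ p), x ∈ levelSet e V p := by
    filter_upwards [hprof.ae_condDistrib he0 hμR hinv] with p hp
    exact ⟨hprof.isConvexCombOfTori he0 hp.1 hp.2, hp.2⟩
  -- The conditional measures are good only almost everywhere, while every value is constrained. One
  -- torus suffices at the exceptional values in the image; the selection alters the kernel on a
  -- null set only, so it need not be measurable.
  have hfill : ∀ p : ℝ × ℝ, ∃ m, (p ∈ moment e V '' compactPart e V →
      IsConvexCombOfTori e V p m) ∧ (p ∉ moment e V '' compactPart e V → m = 0) := by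
    intro p
    by_cases hp : p ∈ moment e V '' compactPart e V
    · obtain ⟨z, hz, rfl⟩ := id hp
      obtain ⟨m, hm⟩ := hprof.exists_isTorusHaar he0 hz
      exact ⟨m, fun _ => isConvexCombOfTori_of_isTorusHaar hz hm, fun hn => absurd hp hn⟩
    · exact ⟨0, fun h => absurd h hp, fun _ => rfl⟩
  choose F hF1 hF0 using hfill
  refine ⟨fun p => if IsConvexCombOfTori e V p (κ p) then κ p else F p, ?_, fun p hp => ?_,
    fun p hp => ?_, ?_, ?_⟩
  · filter_upwards [hgood] with p hp
    rw [if_pos hp.1]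
  · beta_reduce
    split_ifs with hc
    · exact hc
    · exact hF1 p hp
  · beta_reduce
    rw [if_neg fun hc => hp hc.mem_image]
    exact hF0 p hp
  · filter_upwards [hgood] with p hp using hp.1.mem_image
  · filter_upwards [hgood] with p hp
    rw [if_pos hp.1]
    exact hp.2

end Disintegration

end BiInvariant

theorem propositionA1
    (Λ : AddSubgroup (Fin 2 → ℤ)) (hΛ : IsPrimitiveRankOne Λ)
    (e : Fin 2 → ℤ) (he : AddSubgroup.zmultiples e = Λ)
    (V : Torus → ℝ) (hV : SmoothOnTorus V)
    (μ : Measure Phase) (hμ : IsProbabilityMeasure μ) (hμR : μ (regular e V)ᶜ = 0)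
    (hinvPerp : ∀ s : ℝ, MeasurePreserving (hamiltonianFlow (hamPerp e) s) μ μ)
    (hinvP : ∀ t : ℝ, MeasurePreserving (hamiltonianFlow (hamP e V) t) μ μ) :
    (∃ lam : ℝ × ℝ → Measure Phase,
      AEMeasurable lam (μ.map (moment e V)) ∧
      (∀ h ∈ moment e V '' compactPart e V, IsConvexCombOfTori e V h (lam h)) ∧
      (∀ h ∈ moment e V '' regular e V \ moment e V '' compactPart e V, lam h = 0) ∧
      (∀ᵐ h ∂(μ.map (moment e V)), h ∈ moment e V '' compactPart e V) ∧
      ∀ a : Phase → ℝ, Continuous a → HasCompactSupport a → tsupport a ⊆ regular e V →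
        IntegrableOn (fun h => ∫ z in levelSet e V h, a z ∂(lam h))
          (moment e V '' regular e V) (μ.map (moment e V)) ∧
        ∫ z in regular e V, a z ∂μ =
          ∫ h in moment e V '' regular e V,
            (∫ z in levelSet e V h, a z ∂(lam h)) ∂(μ.map (moment e V))) ∧
    ∀ z ∈ regular e V,
      μ {w | ∃ s : ℝ, 0 ≤ s ∧ s ≤ len e ∧ w = hamiltonianFlow (hamPerp e) s z} = 0 := by
  have he0 := ne_zero_of_isPrimitiveRankOne hΛ he
  obtain ⟨W, f, hprof⟩ := exists_isProfile he0 hV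
  have hinv : ∀ a, MeasurePreserving (fun x => orbitMap e V x a) μ μ := fun a =>
    (hinvPerp a.1).comp (hinvP a.2)
  constructor
  · obtain ⟨lam, hae, hconv, hzero, hmem, hlev⟩ := hprof.exists_disintegration he0 hμR hinv
    have hmemR : ∀ᵐ p ∂(μ.map (moment e V)), p ∈ moment e V '' regular e V := by
      filter_upwards [hmem] with p hp using image_mono (fun z hz => hz.1) hp
    refine ⟨lam, ⟨_, (ProbabilityTheory.condDistrib id (moment e V) μ).measurable, hae⟩, hconv,
      fun p hp => hzero p hp.2, hmem, fun a ha hac _ => ?_⟩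
    obtain ⟨h1, h2⟩ := integral_condDistrib_id hprof.continuous_moment.measurable
      (ha.integrable_of_hasCompactSupport hac (μ := μ))
    have heq : (fun p => ∫ z in levelSet e V p, a z ∂(lam p)) =ᵐ[μ.map (moment e V)]
        fun p => ∫ z, a z ∂(ProbabilityTheory.condDistrib id (moment e V) μ p) := by
      filter_upwards [hlev, hae] with p hp hp2
      -- The fibre measure lives on its level set, so restricting to that set changes nothing.
      rw [Measure.restrict_eq_self_of_ae_mem hp, hp2]
    rw [IntegrableOn, Measure.restrict_eq_self_of_ae_mem hmemR,
      Measure.restrict_eq_self_of_ae_mem (show ∀ᵐ z ∂μ, z ∈ regular e V from hμR),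
      integral_congr_ae heq, integrable_congr heq]
    exact ⟨h1, h2⟩
  · intro z hz
    convert hprof.measure_arc_eq_zero he0 hinv hz (isCompact_Icc (a := 0) (b := len e)) using 2
    ext w
    constructor
    · rintro ⟨s, h1, h2, rfl⟩
      exact ⟨s, ⟨h1, h2⟩, hprof.orbitMap_fst he0 z s⟩
    · rintro ⟨s, ⟨h1, h2⟩, rfl⟩
      exact ⟨s, h1, h2, hprof.orbitMap_fst he0 z s⟩
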